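/- Let $\alpha_1,\alpha_2>0$ with $\alpha_1+\alpha_2=1$, $\beta=\alpha_1/\alpha_2$, $\rho>0$ (transmit SNR), $d_1>0$ (distance), $\zeta\in\mathbb R$ (path loss exponent), $\lambda_1=\frac1{1+d_1^{\zeta}}$, and let $T\ge 1$ be an integer (number of transmission rounds). Let $g_1,\dots,g_T$ be independent $\mathcal{CN}(0,1)$ random variables, $h_t=g_t/\sqrt{1+d_1^{\zeta}}$, and let $\gamma_t=\frac{\alpha_1|h_t|^2}{\alpha_2|h_t|^2+1/\rho}$ be the SINR of the far user (user 1) in round $t$. For a target rate $\widehat R_1$ with $0<2^{\widehat R_1}-1<\beta$, the outage probability of user 1 after $T$ rounds of HARQ-CC NOMA is $$P^N_{1,T}=\Pr\Big\{\log_2\Big(1+\sum_{t=1}^T\gamma_t\Big)\le T\widehat R_1\Big\}.$$ Put $r=2^{T\widehat R_1}-1$. For integers $N\ge1$ and even $L\ge2$ let $x_n=\cos\big(\tfrac{2n-1}{2N}\pi\big)$ for $1\le n\le N$, let $\Phi$ be the set of all $(j_1,\dots,j_N)$ of non-negative integers with $j_1+\dots+j_N=T$, and put $$c=\frac{2\alpha_1\beta\pi}{N\lambda_1\rho}e^{\frac1{\alpha_2\lambda_1\rho}},\qquad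 \mathcal C(x)=\frac{\sqrt{1-x^2}}{(2\alpha_1-\alpha_2\beta(x+1))^2}\,e^{-\frac{2\alpha_1}{\alpha_2\lambda_1\rho(2\alpha_1-\alpha_2\beta(x+1))}},$$ $$\hat w_k=(-1)^{\frac L2+k}\sum_{l=\lfloor (k+1)/2\rfloor}^{\min\{k,L/2\}}\frac{l^{L/2+1}}{(L/2)!}\binom{L/2}{l}\binom{2l}{l}\binom{l}{k-l},$$ $$A_{N,L}=c^T\sum_{(j_1,\dots,j_N)\in\Phi}\frac{T!}{\prod_{n=1}^N j_n!}\Big[\prod_{n=1}^N\mathcal C(x_n)^{j_n}\Big]\sum_{m=1}^N\frac{\pi\ln2\,\sqrt{1-x_m^2}}{N(1+x_m)}\Big[\sum_{k=1}^L\hat w_k\,e^{-\frac{\sum_{n=1}^N j_n\beta(x_n+1)\,k\ln 2}{r(1+x_m)}}\Big].$$ Then $A_{N,L}$ approximates $P^N_{1,T}$ in the following sense: for every even $L\ge2$ the limit $\lim_{N\to\infty}A_{N,L}$ exists, and $$\lim_{L\to\infty,\;L\text{ even}}\ \lim_{N\to\infty}A_{N,L}=P^N_{1,T}.$$ -/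

import Mathlib

open MeasureTheory ProbabilityTheory Filter Topology

noncomputable section

namespace HarqNoma

/-- The standard circularly symmetric complex Gaussian law `CN(0,1)`: independent real and
imaginary parts, each centred normal with variance `1/2`. -/
def complexGaussian : Measure ℂ :=
  ((gaussianReal 0 (1 / 2)).prod (gaussianReal 0 (1 / 2))).map (fun p : ℝ × ℝ => ⟨p.1, p.2⟩)

/-- The average channel power gain `1 / (1 + d ^ ζ)` at distance `d` with path loss exponent `ζ`. -/
def pathGain (d ζ : ℝ) : ℝ := 1 / (1 + d ^ ζ)

/-- The channel coefficient `g / √(1 + d ^ ζ)` obtained from the small-scale fading `g`. -/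
def channel (d ζ : ℝ) (g : ℂ) : ℂ := g / (Real.sqrt (1 + d ^ ζ) : ℂ)

/-- The received SINR of user 1 for its own signal, when the channel coefficient is `h`, the power
allocation factors are `α₁, α₂` and the transmit SNR is `ρ`. -/
def sinr (α₁ α₂ ρ : ℝ) (h : ℂ) : ℝ := α₁ * ‖h‖ ^ 2 / (α₂ * ‖h‖ ^ 2 + 1 / ρ)

/-- The outage probability of user 1 after `T` rounds of chase combining with target rate `R`;
`g t` is the small-scale fading in round `t`. -/
def outage {Ω : Type*} [MeasurableSpace Ω] (P : Measure Ω) (α₁ α₂ ρ d ζ R : ℝ) (T : ℕ)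
    (g : Fin T → Ω → ℂ) : ℝ :=
  P.real {ω | Real.logb 2 (1 + ∑ t, sinr α₁ α₂ ρ (channel d ζ (g t ω))) ≤ T * R}

/-- The Chebyshev node `cos ((2 n - 1) π / (2 N))`, `n = 1, …, N`; the index `i : Fin N` stands for
`n = i + 1`. -/
def node (N : ℕ) (i : Fin N) : ℝ :=
  Real.cos ((2 * ((i : ℝ) + 1) - 1) / (2 * N) * Real.pi)

/-- The Gaver–Stehfest weight `w_k` of order `L` (with `L` even). -/
def weight (L k : ℕ) : ℝ :=
  (-1) ^ (L / 2 + k) * ∑ l ∈ Finset.Icc ((k + 1) / 2) (min k (L / 2)),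
    (l : ℝ) ^ (L / 2 + 1) / ((L / 2).factorial : ℝ) *
      ((L / 2).choose l : ℝ) * ((2 * l).choose l : ℝ) * (l.choose (k - l) : ℝ)

/-- The constant `c = (2 α₁ β π / (N lam ρ)) e ^ (1 / (α₂ lam ρ))`, where `β = α₁ / α₂`. -/
def cConst (α₁ α₂ ρ lam : ℝ) (N : ℕ) : ℝ :=
  2 * α₁ * (α₁ / α₂) * Real.pi / (N * lam * ρ) * Real.exp (1 / (α₂ * lam * ρ))

/-- The function `C(x)`, with `β = α₁ / α₂`. -/
def cFun (α₁ α₂ ρ lam x : ℝ) : ℝ :=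
  Real.sqrt (1 - x ^ 2) / (2 * α₁ - α₂ * (α₁ / α₂) * (x + 1)) ^ 2 *
    Real.exp (-(2 * α₁ / (α₂ * lam * ρ * (2 * α₁ - α₂ * (α₁ / α₂) * (x + 1)))))

/-- The index set `Φ` of all `(j_1, …, j_N)` of natural numbers with sum `T`. -/
def indexSet (N T : ℕ) : Finset (Fin N → ℕ) := Finset.piAntidiag Finset.univ T

/-- The closed-form expression with `N` Chebyshev nodes and Gaver–Stehfest order `L`, at the
threshold `r` for the sum of the `T` SINRs. -/
def closedForm (α₁ α₂ ρ lam r : ℝ) (T N L : ℕ) : ℝ :=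
  cConst α₁ α₂ ρ lam N ^ T *
    ∑ j ∈ indexSet N T,
      ((T.factorial : ℝ) / ∏ n, ((j n).factorial : ℝ)) *
        (∏ n, cFun α₁ α₂ ρ lam (node N n) ^ j n) *
        ∑ m : Fin N,
          Real.pi * Real.log 2 * Real.sqrt (1 - node N m ^ 2) / (N * (1 + node N m)) *
            ∑ k ∈ Finset.Icc 1 L, weight L k *
              Real.exp (-((∑ n, (j n : ℝ) * (α₁ / α₂) * (node N n + 1)) * k * Real.log 2 /
                (r * (1 + node N m))))

end HarqNoma

end

namespace HarqNoma

/-! Write `K = 1 / (α₂ λ₁ ρ)`. Each SINR is `β X / (X + K)` with `X = |g|²` standard exponential.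
Let `F` be the distribution function of the sum of `T` of them, and let `r = 2 ^ (T R) - 1`, so the
outage probability is `F r`.

The limit in `N`. The substitution `X = K (1 + cos φ) / (1 - cos φ)` turns the Laplace transform of
one SINR into an integral over `(0, π)`, and Chebyshev nodes are cosines of cell midpoints. By the
multinomial theorem the closed form is therefore a midpoint sum in an outer angle of the `T`-th
power of a midpoint sum in `φ` (`closedForm_eq`). The outer weight `sin / (1 + cos)` is not
integrable at `π`, but the inner sum is `O(s ^ (-1/2))` uniformly in `N` with `s` proportional to `1
/ (1 + cos)`, so dominated convergence applies. By Fubini the limiting outer integral is the Laplace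
transform of `G u = F (r u) / u` at `k log 2`.

The limit in `L`. The sum over `k` is then the Gaver–Stehfest functional of `G`, that is, `G`
integrated against a polynomial kernel in `y = 2 ^ (-u)`. The kernel divided by `y` has integral 1,
the kernel is symmetric about `y = 1/2`, and it satisfies a Gaussian bound around `1/2`
(`exists_abs_stehfestPoly_le_gaussian`), obtained from a Cauchy estimate on a well-chosen circle. By
symmetry the first-order error cancels, so the functional tends to `G 1 = F r` whenever `G` is
bounded and differentiable at `1`. Boundedness comes from the bounded density of the SINR;
differentiability comes from the explicit law for `T = 1` and from smoothing by convolution for `T ≥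
2`. -/

/-! ### Cauchy estimate for the Stehfest coefficient sum -/

theorem two_mul_cosh_sub_one_le (x : ℝ) :
    2 * (Real.cosh x - 1) ≤ x ^ 2 * Real.exp (x ^ 2 / 12) := by
  have h1 := Real.hasSum_cosh x
  have h2 : HasSum (fun n : ℕ => x ^ (2 * (n + 1)) / ((2 * (n + 1)).factorial : ℝ))
      (Real.cosh x - 1) := by
    have := (hasSum_nat_add_iff' 1).2 h1
    simpa using this
  have h3 : HasSum (fun n : ℕ => x ^ 2 * ((x ^ 2 / 12) ^ n / (n.factorial : ℝ)))
      (x ^ 2 * Real.exp (x ^ 2 / 12)) := by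
    have := (NormedSpace.expSeries_div_hasSum_exp (x ^ 2 / 12)).mul_left (x ^ 2)
    rwa [← Real.exp_eq_exp_ℝ] at this
  refine hasSum_le (fun n => ?_) (h2.mul_left 2) h3
  -- The two power series are compared term by term. The induction needs `12 (k + 1) ≤ (2k + 4)(2k +
  -- 3)`, an equality at `k = 0`, whence the constant 12.
  have hf : 2 * 12 ^ n * n.factorial ≤ (2 * (n + 1)).factorial := by
    induction n with
    | zero => simp
    | succ k ih =>
      have e : (2 * (k + 1 + 1)).factorial
          = (2 * k + 4) * ((2 * k + 3) * (2 * (k + 1)).factorial) := by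
        rw [show 2 * (k + 1 + 1) = (2 * (k + 1) + 1) + 1 by ring, Nat.factorial_succ,
          Nat.factorial_succ]
        ring
      rw [e, Nat.factorial_succ]
      calc 2 * 12 ^ (k + 1) * ((k + 1) * k.factorial)
          = 12 * (k + 1) * (2 * 12 ^ k * k.factorial) := by ring
        _ ≤ (2 * k + 4) * (2 * k + 3) * (2 * (k + 1)).factorial := by
          apply Nat.mul_le_mul _ ih
          nlinarith
        _ = _ := by ring
  have hf' : (2 : ℝ) * 12 ^ n * n.factorial ≤ (2 * (n + 1)).factorial := by exact_mod_cast hf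
  have hp : (0 : ℝ) < n.factorial := by exact_mod_cast n.factorial_pos
  have hx : 0 ≤ x ^ (2 * (n + 1)) := by rw [pow_mul]; positivity
  have e : x ^ 2 * ((x ^ 2 / 12) ^ n / (n.factorial : ℝ))
      = 2 * (x ^ (2 * (n + 1)) / (2 * 12 ^ n * n.factorial)) := by
    rw [div_pow]; field_simp; ring
  rw [e]
  gcongr

theorem one_add_le_exp_sub_sq {u : ℝ} (h1 : -1 ≤ u) (h2 : u ≤ 2) :
    1 + u ≤ Real.exp (u - u ^ 2 / 6) := by
  rcases le_or_gt 0 u with hu | hu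
  · have hw : 0 ≤ u - u ^ 2 / 6 := by nlinarith
    have := Real.quadratic_le_exp_of_nonneg hw
    have h3 : (u - u ^ 2 / 6) ^ 2 / 2 ≥ u ^ 2 / 6 := by
      have : u - u ^ 2 / 6 ≥ 2 / 3 * u := by nlinarith
      nlinarith
    linarith
  · rcases h1.eq_or_lt with h1 | h1
    · rw [← h1]; norm_num; positivity
    have ha : |-u| < 1 := by rw [abs_neg, abs_lt]; constructor <;> linarith
    have hs := Real.hasSum_pow_div_log_of_abs_lt_one ha
    have := sum_le_hasSum (Finset.range 2) (fun i _ => by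
      have : 0 ≤ -u := by linarith
      positivity) hs
    simp [Finset.sum_range_succ] at this
    have h3 : Real.log (1 + u) ≤ u - u ^ 2 / 6 := by nlinarith
    calc 1 + u = Real.exp (Real.log (1 + u)) := (Real.exp_log (by linarith)).symm
      _ ≤ _ := Real.exp_le_exp.2 h3

/-- With `σ = Re t - b`, the squared norm is `e ^ σ (2 cosh σ - 2 cos y)`, essentially `e ^ σ (σ² +
y²) = 2 b e ^ σ (1 + u)`. On the radius `√(2b)` one has `σ + u = -b/2`, so the dependence on `t`
cancels to first order. -/
theorem norm_exp_sub_one_sq_le (b : ℝ) (hb0 : 0 < b) (hb1 : b ≤ 1) (t : ℂ)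
    (ht : ‖t‖ ^ 2 = 2 * b) :
    ‖Complex.exp (t - b) - 1‖ ^ 2 ≤ 2 * b * Real.exp (-(2 * b / 5)) := by
  obtain ⟨x, y⟩ := t
  have hxy : x ^ 2 + y ^ 2 = 2 * b := by
    rw [← ht, Complex.sq_norm, Complex.normSq_mk]; ring
  set σ := x - b with hσ
  set u := b / 2 - x with hu
  have e1 : ‖Complex.exp ((⟨x, y⟩ : ℂ) - b) - 1‖ ^ 2
      = Real.exp σ * (2 * Real.cosh σ - 2 * Real.cos y) := by
    rw [Complex.sq_norm, Complex.normSq_apply]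
    simp only [Complex.sub_re, Complex.sub_im, Complex.exp_re, Complex.exp_im, Complex.ofReal_re,
      Complex.ofReal_im, Complex.one_re, Complex.one_im, sub_zero]
    rw [← hσ, Real.cosh_eq, Real.exp_neg]
    have := Real.exp_pos σ
    have hc := Real.sin_sq_add_cos_sq y
    field_simp
    linear_combination (Real.exp σ) ^ 2 * hc
  have h1 := two_mul_cosh_sub_one_le σ
  have h2 := @Real.one_sub_sq_div_two_le_cos y
  have h3 : (1 : ℝ) ≤ Real.exp (σ ^ 2 / 12) := Real.one_le_exp (by positivity)
  have h4 : 2 * Real.cosh σ - 2 * Real.cos y ≤ (σ ^ 2 + y ^ 2) * Real.exp (σ ^ 2 / 12) := by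
    nlinarith [sq_nonneg y]
  have e2 : σ ^ 2 + y ^ 2 = 2 * b * (1 + u) := by
    rw [hσ, hu]; linear_combination hxy
  have hu1 : -1 ≤ u := by
    have : 0 ≤ 2 * b * (1 + u) := by rw [← e2]; positivity
    nlinarith
  have hu2 : u ≤ 2 := by
    have : x ^ 2 ≤ 2 := by nlinarith [sq_nonneg y]
    have : -x ≤ 3 / 2 := by nlinarith
    linarith
  have h5 := one_add_le_exp_sub_sq hu1 hu2
  rw [e1]
  calc Real.exp σ * (2 * Real.cosh σ - 2 * Real.cos y)
      ≤ Real.exp σ * (2 * b * Real.exp (u - u ^ 2 / 6) * Real.exp (σ ^ 2 / 12)) := by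
        rw [e2] at h4
        refine mul_le_mul_of_nonneg_left (h4.trans ?_) (Real.exp_pos _).le
        gcongr
    _ = 2 * b * Real.exp (σ + (u - u ^ 2 / 6) + σ ^ 2 / 12) := by
        rw [Real.exp_add, Real.exp_add]; ring
    -- Since `(u + b/2)² ≤ 2u² + b²/2`, the loss `σ²/12` is absorbed by the gain `u²/6` up to
    -- `b²/24`, and `-b/2 + b²/24 ≤ -2b/5` for `b ≤ 1`.
    _ ≤ _ := by
        gcongr
        have : σ = -u - b / 2 := by rw [hσ, hu]; ring
        rw [this]
        nlinarith [sq_nonneg (u - b / 2)]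

/-- For `a = e ^ (-b)` with `b ≤ 1` the radius is `√(2b)`. For smaller `a` the radius stays at `√2`,
so that `e ^ t` remains bounded. -/
theorem exists_radius_norm_mul_exp_sub_one_le {a : ℝ} (ha0 : 0 ≤ a) (ha1 : a < 1) :
    ∃ R : ℝ, 0 < R ∧ R ≤ √2 ∧ √(1 - a) ≤ R ∧
      ∀ t : ℂ, ‖t‖ = R → ‖a * Complex.exp t - 1‖ ≤ R * Real.exp (-((1 - a) / 5)) := by
  have key : ∀ b : ℝ, 0 < b → b ≤ 1 → ∀ t : ℂ, ‖t‖ = √(2 * b) →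
      ‖(Real.exp (-b) : ℂ) * Complex.exp t - 1‖ ≤ √(2 * b) * Real.exp (-(b / 5)) := by
    intro b hb0 hb1 t ht
    have := norm_exp_sub_one_sq_le b hb0 hb1 t (by rw [ht, Real.sq_sqrt (by positivity)])
    rw [show (Complex.exp (t - b)) = (Real.exp (-b) : ℂ) * Complex.exp t by
      rw [Complex.ofReal_exp, ← Complex.exp_add]; congr 1; push_cast; ring] at this
    refine le_of_sq_le_sq ?_ (by positivity)
    rw [mul_pow, Real.sq_sqrt (by positivity), ← Real.exp_nat_mul]
    rwa [show ((2 : ℕ) : ℝ) * -(b / 5) = -(2 * b / 5) by push_cast; ring]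
  rcases le_or_gt a (Real.exp (-1)) with h | h
  · refine ⟨√2, by positivity, le_rfl, Real.sqrt_le_sqrt (by linarith), fun t ht => ?_⟩
    have h1 := key 1 one_pos le_rfl t (by rw [ht, mul_one])
    rw [mul_one] at h1
    set s := a * Real.exp 1 with hs
    have hs0 : 0 ≤ s := by positivity
    have hs1 : s ≤ 1 := by
      calc s ≤ Real.exp (-1) * Real.exp 1 := mul_le_mul_of_nonneg_right h (Real.exp_pos _).le
        _ = 1 := by rw [← Real.exp_add]; simp
    have ha : a = s * Real.exp (-1) := by
      rw [hs, mul_assoc, ← Real.exp_add]; simp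
    -- A convex combination of the value for `b = 1` and of `-1`; the latter is harmless because `1
    -- ≤ √2 e ^ (-1/5)`.
    have e : (a : ℂ) * Complex.exp t - 1
        = s * ((Real.exp (-1) : ℂ) * Complex.exp t - 1) + ((1 - s : ℝ) : ℂ) * (-1) := by
      rw [ha]; push_cast; ring
    have h2 : (1 : ℝ) ≤ √2 * Real.exp (-(1 / 5)) := by
      have h3 : (1.41 : ℝ) ≤ √2 := Real.le_sqrt_of_sq_le (by norm_num)
      have h4 := Real.add_one_le_exp (-(1 / 5 : ℝ))
      nlinarith
    have h5 : √2 * Real.exp (-(1 / 5)) ≤ √2 * Real.exp (-((1 - a) / 5)) := by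
      exact mul_le_mul_of_nonneg_left (Real.exp_le_exp.2 (by linarith)) (Real.sqrt_nonneg _)
    refine le_trans ?_ h5
    rw [e]
    refine (norm_add_le _ _).trans ?_
    rw [norm_mul, norm_mul, Complex.norm_real, Complex.norm_real, norm_neg, norm_one,
      Real.norm_of_nonneg hs0, Real.norm_of_nonneg (by linarith)]
    nlinarith
  · have hpos : 0 < a := (Real.exp_pos _).trans h
    set b := -Real.log a with hb
    have hb0 : 0 < b := by rw [hb]; linarith [Real.log_neg hpos ha1]
    have hb1 : b ≤ 1 := by
      have := (Real.lt_log_iff_exp_lt hpos).2 h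
      linarith
    have hab : 1 - a ≤ b := by linarith [Real.log_le_sub_one_of_pos hpos]
    refine ⟨√(2 * b), by positivity, Real.sqrt_le_sqrt (by linarith),
      Real.sqrt_le_sqrt (by linarith), fun t ht => ?_⟩
    have := key b hb0 hb1 t ht
    rw [hb, neg_neg, Real.exp_log hpos, ← hb] at this
    refine this.trans ?_
    gcongr

/-- The coefficient sum obtained by differentiating `e ^ t * (a * e ^ t - 1) ^ m` at `t = 0`. -/
noncomputable def stehfestCore (m : ℕ) (a : ℝ) : ℝ :=
  ∑ i ∈ Finset.range (m + 1),
    (-1) ^ (m + i) * ((i : ℝ) + 1) ^ (m + 1) / (m.factorial : ℝ) * (m.choose i : ℝ) * a ^ i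

theorem iteratedDeriv_exp_mul_pow (m : ℕ) (a : ℝ) :
    iteratedDeriv (m + 1) (fun t : ℂ => Complex.exp t * (a * Complex.exp t - 1) ^ m) 0
      = ((m.factorial * stehfestCore m a : ℝ) : ℂ) := by
  have e : (fun t : ℂ => Complex.exp t * (a * Complex.exp t - 1) ^ m)
      = fun t : ℂ => ∑ i ∈ Finset.range (m + 1),
        ((-1) ^ (m + i) * (m.choose i : ℂ) * (a : ℂ) ^ i) * Complex.exp (((i : ℂ) + 1) * t) := by
    funext t
    rw [sub_eq_add_neg, add_pow, Finset.mul_sum]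
    refine Finset.sum_congr rfl fun i hi => ?_
    have hi' : i ≤ m := Nat.lt_succ_iff.1 (Finset.mem_range.1 hi)
    have e2 : ((-1 : ℂ)) ^ (m - i) = (-1) ^ (m + i) := by
      rw [show m + i = (m - i) + 2 * i by omega, pow_add, pow_mul]; simp
    rw [e2, mul_pow, add_mul, one_mul, Complex.exp_add, ← Complex.exp_nat_mul]
    ring
  rw [e, iteratedDeriv_fun_sum (fun i _ => by fun_prop)]
  rw [stehfestCore, Finset.mul_sum]
  push_cast
  refine Finset.sum_congr rfl fun i _ => ?_
  rw [iteratedDeriv_const_mul_field, iteratedDeriv_cexp_const_mul]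
  have : (m.factorial : ℂ) ≠ 0 := by exact_mod_cast m.factorial_ne_zero
  field_simp
  simp

/-- Cauchy's estimate for the derivative of order `m + 1` on the circle of the previous lemma: the
powers `R ^ m` cancel, leaving one factor `1 / R ≤ 1 / √(1 - a)` and the exponential gain to the
power `m`. -/
theorem abs_stehfestCore_le (m : ℕ) {a : ℝ} (ha0 : 0 ≤ a) (ha1 : a < 1) :
    |stehfestCore m a| ≤
      (m + 1) * Real.exp √2 / √(1 - a) * Real.exp (-(m * (1 - a) / 5)) := by
  obtain ⟨R, hR0, hR2, hRa, hR⟩ := exists_radius_norm_mul_exp_sub_one_le ha0 ha1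
  have hC := Complex.norm_iteratedDeriv_le_of_forall_mem_sphere_norm_le (c := 0) (R := R)
    (C := Real.exp √2 * (R * Real.exp (-((1 - a) / 5))) ^ m)
    (f := fun t : ℂ => Complex.exp t * (a * Complex.exp t - 1) ^ m) (m + 1) hR0
    (Differentiable.diffContOnCl (by fun_prop)) (fun t ht => by
      have ht' : ‖t‖ = R := by simpa using ht
      rw [norm_mul, norm_pow]
      have h1 : ‖Complex.exp t‖ ≤ Real.exp √2 := by
        rw [Complex.norm_exp]
        exact Real.exp_le_exp.2 ((Complex.re_le_norm t).trans (ht'.le.trans hR2))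
      gcongr
      exact hR t ht')
  rw [iteratedDeriv_exp_mul_pow, Complex.norm_real, Real.norm_eq_abs, abs_mul,
    abs_of_nonneg (by positivity)] at hC
  have hm : (0 : ℝ) < m.factorial := by exact_mod_cast m.factorial_pos
  have h1a : 0 < √(1 - a) := Real.sqrt_pos.2 (by linarith)
  have e : ((m + 1).factorial : ℝ) * (Real.exp √2 * (R * Real.exp (-((1 - a) / 5))) ^ m) / R ^ (m + 1)
      = m.factorial * ((m + 1) * Real.exp √2 / R * Real.exp (-(m * (1 - a) / 5))) := by
    rw [Nat.factorial_succ, mul_pow, ← Real.exp_nat_mul, pow_succ]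
    push_cast
    rw [show (m : ℝ) * -((1 - a) / 5) = -(m * (1 - a) / 5) by ring]
    field_simp
  rw [e] at hC
  refine (le_of_mul_le_mul_left hC hm).trans ?_
  gcongr

/-! ### The Gaver–Stehfest kernel: normalisation and Gaussian concentration -/

theorem integral_pow_mul_one_sub_pow (a b : ℕ) :
    ∫ x in (0 : ℝ)..1, x ^ a * (1 - x) ^ b
      = (a.factorial : ℝ) * b.factorial / ((a + b + 1).factorial : ℝ) := by
  have h := Complex.betaIntegral_eq_Gamma_mul_div ((a : ℂ) + 1) ((b : ℂ) + 1)
    (by simp; positivity) (by simp; positivity)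
  rw [Complex.Gamma_nat_eq_factorial, Complex.Gamma_nat_eq_factorial,
    show (a : ℂ) + 1 + (b + 1) = ((a + b + 1 : ℕ) : ℂ) + 1 by push_cast; ring,
    Complex.Gamma_nat_eq_factorial, Complex.betaIntegral] at h
  have e : ∀ x : ℝ, (x : ℂ) ^ ((a : ℂ) + 1 - 1) * (1 - (x : ℂ)) ^ ((b : ℂ) + 1 - 1)
      = ((x ^ a * (1 - x) ^ b : ℝ) : ℂ) := by
    intro x
    simp
  simp_rw [e] at h
  rw [intervalIntegral.integral_ofReal] at h
  apply Complex.ofReal_injective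
  push_cast
  exact h

/-- The `m`-th forward difference of `x ^ m`, taken at `1`, is `m!`. -/
theorem sum_neg_one_pow_mul_choose_mul_pow (m : ℕ) :
    ∑ i ∈ Finset.range (m + 1), (-1 : ℝ) ^ (m + i) * ((i : ℝ) + 1) ^ m / (m.factorial : ℝ) *
      (m.choose i : ℝ) = 1 := by
  have h := congrFun (fwdDiff_iter_eq_factorial (R := ℝ) (n := m)) 1
  rw [fwdDiff_iter_eq_sum_shift] at h
  have hm : (m.factorial : ℝ) ≠ 0 := by exact_mod_cast m.factorial_ne_zero
  have h2 : (m.factorial : ℝ) = ∑ i ∈ Finset.range (m + 1),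
      (-1 : ℝ) ^ (m + i) * ((i : ℝ) + 1) ^ m * (m.choose i : ℝ) := by
    refine Eq.trans (by simp) (h.symm.trans (Finset.sum_congr rfl fun i hi => ?_))
    have hi' : i ≤ m := Nat.lt_succ_iff.1 (Finset.mem_range.1 hi)
    have e2 : ((-1 : ℝ)) ^ (m - i) = (-1) ^ (m + i) := by
      rw [show m + i = (m - i) + 2 * i by omega, pow_add, pow_mul]; simp
    simp only [zsmul_eq_mul, nsmul_eq_mul, mul_one]
    push_cast
    rw [e2]; ring
  calc _ = (∑ i ∈ Finset.range (m + 1),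
      (-1 : ℝ) ^ (m + i) * ((i : ℝ) + 1) ^ m * (m.choose i : ℝ)) / m.factorial := by
        rw [Finset.sum_div]; exact Finset.sum_congr rfl fun i _ => by ring
    _ = 1 := by rw [← h2, div_self hm]

/-- The Gaver–Stehfest kernel of order `2 * n` in the variable `y = 2 ^ (-u)`. -/
noncomputable def stehfestPoly (n : ℕ) (y : ℝ) : ℝ :=
  ∑ k ∈ Finset.Icc 1 (2 * n), weight (2 * n) k * y ^ k

theorem weight_two_mul (n k : ℕ) : weight (2 * n) k =
    ∑ l ∈ (Finset.range (n + 1)).filter (fun l => l ≤ k ∧ k ≤ 2 * l),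
      (-1) ^ (n + k) * ((l : ℝ) ^ (n + 1) / (n.factorial : ℝ) *
      (n.choose l : ℝ) * ((2 * l).choose l : ℝ) * (l.choose (k - l) : ℝ)) := by
  rw [weight, Nat.mul_div_cancel_left n two_pos, Finset.mul_sum]
  refine Finset.sum_congr ?_ fun _ _ => rfl
  ext l
  simp only [Finset.mem_Icc, Finset.mem_filter, Finset.mem_range, le_min_iff]
  omega

/-- After exchanging the sums and putting `k = l + i`, the sum over `i` is the binomial expansion of
`(1 - y) ^ l`. This form exhibits the symmetry `y ↔ 1 - y`. -/
theorem stehfestPoly_eq (n : ℕ) (y : ℝ) : stehfestPoly n y =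
    ∑ l ∈ Finset.range (n + 1), (-1) ^ (n + l) * (l : ℝ) ^ (n + 1) / (n.factorial : ℝ) *
      (n.choose l : ℝ) * ((2 * l).choose l : ℝ) * (y * (1 - y)) ^ l := by
  simp_rw [stehfestPoly, weight_two_mul, Finset.sum_mul, Finset.sum_filter]
  rw [Finset.sum_comm]
  refine Finset.sum_congr rfl fun l hl => ?_
  rcases Nat.eq_zero_or_pos l with rfl | hl0
  · simp
  have hl' : l ≤ n := Nat.lt_succ_iff.1 (Finset.mem_range.1 hl)
  rw [← Finset.sum_filter]
  have : (Finset.Icc 1 (2 * n)).filter (fun k => l ≤ k ∧ k ≤ 2 * l)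
      = (Finset.range (l + 1)).image (fun i => l + i) := by
    ext k
    simp only [Finset.mem_Icc, Finset.mem_filter, Finset.mem_image, Finset.mem_range]
    constructor
    · rintro h; exact ⟨k - l, by omega, by omega⟩
    · rintro ⟨i, hi, rfl⟩; omega
  rw [this, Finset.sum_image (fun a _ b _ h => by simpa using h), mul_pow, sub_eq_neg_add 1 y,
    add_pow, Finset.mul_sum, Finset.mul_sum]
  refine Finset.sum_congr rfl fun i hi => ?_
  rw [Nat.add_sub_cancel_left, neg_pow, one_pow, ← add_assoc, pow_add _ (n + l), pow_add y]
  ring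

theorem stehfestPoly_succ (m : ℕ) (y : ℝ) : stehfestPoly (m + 1) y =
    y * (1 - y) * ∑ i ∈ Finset.range (m + 1),
      (-1) ^ (m + i) * ((i : ℝ) + 1) ^ (m + 1) / (m.factorial : ℝ) * (m.choose i : ℝ) *
        ((2 * (i + 1)).choose (i + 1) : ℝ) * (y * (1 - y)) ^ i := by
  rw [stehfestPoly_eq, Finset.sum_range_succ', Finset.mul_sum]
  simp only [Nat.cast_zero, ne_eq, Nat.add_eq_zero_iff, one_ne_zero, and_false, not_false_eq_true,
    zero_pow, mul_zero, zero_div, zero_mul, add_zero]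
  refine Finset.sum_congr rfl fun i _ => ?_
  have hc : ((i : ℝ) + 1) * ((m + 1).choose (i + 1) : ℝ) = (m + 1) * (m.choose i : ℝ) := by
    have := Nat.add_one_mul_choose_eq m i
    have h2 : (((m + 1) * m.choose i : ℕ) : ℝ) = (((m + 1).choose (i + 1) * (i + 1) : ℕ) : ℝ) := by
      rw [this]
    push_cast at h2; linarith
  rw [Nat.factorial_succ, show m + 1 + (i + 1) = m + i + 2 by ring, pow_add (-1 : ℝ) (m + i)]
  have hm : (m.factorial : ℝ) ≠ 0 := by exact_mod_cast m.factorial_ne_zero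
  push_cast
  have hm1 : (m : ℝ) + 1 ≠ 0 := by positivity
  field_simp
  rw [pow_succ ((i : ℝ) + 1) (m + 1)]
  linear_combination (((i : ℝ) + 1) ^ (m + 1) * ((2 * (i + 1)).choose (i + 1) : ℝ)
    * (y * (1 - y)) ^ (i + 1)) * hc

/-- The Beta integral of `y ^ i (1 - y) ^ (i + 1)` cancels the central binomial coefficient up to a
factor `1 / (i + 1)`, which leaves the finite-difference sum. -/
theorem integral_stehfestPoly_div (m : ℕ) :
    ∫ y in (0 : ℝ)..1, stehfestPoly (m + 1) y / y = 1 := by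
  have e : ∀ y : ℝ, y ≠ 0 → stehfestPoly (m + 1) y / y = ∑ i ∈ Finset.range (m + 1),
      (-1) ^ (m + i) * ((i : ℝ) + 1) ^ (m + 1) / (m.factorial : ℝ) * (m.choose i : ℝ) *
        ((2 * (i + 1)).choose (i + 1) : ℝ) * (y ^ i * (1 - y) ^ (i + 1)) := by
    intro y hy
    rw [stehfestPoly_succ, mul_assoc, mul_div_cancel_left₀ _ hy, Finset.mul_sum]
    refine Finset.sum_congr rfl fun i _ => ?_
    rw [mul_pow, pow_succ (1 - y)]; ring
  rw [intervalIntegral.integral_congr_ae (g := fun y => ∑ i ∈ Finset.range (m + 1),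
      (-1) ^ (m + i) * ((i : ℝ) + 1) ^ (m + 1) / (m.factorial : ℝ) * (m.choose i : ℝ) *
        ((2 * (i + 1)).choose (i + 1) : ℝ) * (y ^ i * (1 - y) ^ (i + 1)))
      (Eventually.of_forall fun y hy => e y (by
        rw [Set.uIoc_of_le zero_le_one] at hy; exact hy.1.ne')),
    intervalIntegral.integral_finsetSum
      (fun i _ => Continuous.intervalIntegrable (by fun_prop) _ _)]
  refine Eq.trans (Finset.sum_congr rfl fun i _ => ?_) (sum_neg_one_pow_mul_choose_mul_pow m)
  rw [intervalIntegral.integral_const_mul, integral_pow_mul_one_sub_pow]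
  have h1 := Nat.choose_mul_factorial_mul_factorial (n := 2 * (i + 1)) (k := i + 1) (by omega)
  rw [show 2 * (i + 1) - (i + 1) = i + 1 by omega, Nat.factorial_succ i] at h1
  have h2 : (((2 * (i + 1)).choose (i + 1) : ℕ) : ℝ) * ((i + 1) * i.factorial)
      * ((i + 1) * i.factorial) = ((2 * (i + 1)).factorial : ℝ) := by exact_mod_cast h1
  rw [show i + (i + 1) + 1 = 2 * (i + 1) by ring, ← h2, Nat.factorial_succ i]
  have hm : (m.factorial : ℝ) ≠ 0 := by exact_mod_cast m.factorial_ne_zero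
  have hi : (i.factorial : ℝ) ≠ 0 := by exact_mod_cast i.factorial_ne_zero
  have hc : ((2 * (i + 1)).choose (i + 1) : ℝ) ≠ 0 := by
    exact_mod_cast (Nat.choose_pos (by omega)).ne'
  have hi1 : (i : ℝ) + 1 ≠ 0 := by positivity
  push_cast
  rw [pow_succ ((i : ℝ) + 1) m]
  field_simp

theorem integral_sin_pow_two_mul (j : ℕ) :
    ∫ x in (0 : ℝ)..Real.pi, Real.sin x ^ (2 * j)
      = Real.pi * (((2 * j).choose j : ℝ) / 4 ^ j) := by
  rw [integral_sin_pow_even]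
  congr 1
  induction j with
  | zero => simp
  | succ j ih =>
    rw [Finset.prod_range_succ, ih]
    have h := Nat.succ_mul_centralBinom_succ j
    simp only [Nat.centralBinom] at h
    have h2 : ((j : ℝ) + 1) * ((2 * (j + 1)).choose (j + 1) : ℝ)
        = 2 * (2 * j + 1) * ((2 * j).choose j : ℝ) := by exact_mod_cast h
    have hj : (j : ℝ) + 1 ≠ 0 := by positivity
    rw [pow_succ]
    field_simp
    linear_combination -2 * h2

/-- Central binomial coefficients are moments of `4 sin² θ` under the uniform law on `(0, π)`.
Averaging over `θ` thus removes them and reduces the kernel to `stehfestCore`. -/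
theorem stehfestPoly_succ_eq_integral (m : ℕ) (y : ℝ) :
    stehfestPoly (m + 1) y = 1 / Real.pi * ∫ θ in (0 : ℝ)..Real.pi,
      4 * (y * (1 - y)) * Real.sin θ ^ 2 *
        stehfestCore m (4 * (y * (1 - y)) * Real.sin θ ^ 2) := by
  have e : ∀ θ : ℝ, 4 * (y * (1 - y)) * Real.sin θ ^ 2 *
        stehfestCore m (4 * (y * (1 - y)) * Real.sin θ ^ 2) = ∑ i ∈ Finset.range (m + 1),
      (-1) ^ (m + i) * ((i : ℝ) + 1) ^ (m + 1) / (m.factorial : ℝ) * (m.choose i : ℝ) *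
        (4 * (y * (1 - y))) ^ (i + 1) * Real.sin θ ^ (2 * (i + 1)) := by
    intro θ
    rw [stehfestCore, Finset.mul_sum]
    refine Finset.sum_congr rfl fun i _ => ?_
    rw [mul_pow, ← pow_mul, mul_add 2 i 1, pow_add (Real.sin θ)]
    ring
  simp_rw [e]
  rw [intervalIntegral.integral_finsetSum
      (fun i _ => Continuous.intervalIntegrable (by fun_prop) _ _), stehfestPoly_succ,
    Finset.mul_sum, Finset.mul_sum]
  refine Finset.sum_congr rfl fun i _ => ?_
  rw [intervalIntegral.integral_const_mul, integral_sin_pow_two_mul, mul_pow 4]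
  have := Real.pi_ne_zero
  field_simp
  ring

theorem integral_sin_mul_exp_neg_cos_sq_le {b : ℝ} (hb : 0 < b) :
    ∫ θ in (0 : ℝ)..Real.pi, Real.sin θ * Real.exp (-b * Real.cos θ ^ 2) ≤ √(Real.pi / b) := by
  have h := intervalIntegral.integral_comp_mul_deriv (a := 0) (b := Real.pi) (f := Real.cos)
    (f' := fun x => -Real.sin x) (g := fun x => Real.exp (-b * x ^ 2))
    (fun x _ => Real.hasDerivAt_cos x) (by fun_prop) (by fun_prop)
  have e : ∫ θ in (0 : ℝ)..Real.pi, Real.sin θ * Real.exp (-b * Real.cos θ ^ 2)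
      = ∫ x in (-1 : ℝ)..1, Real.exp (-b * x ^ 2) := by
    rw [intervalIntegral.integral_symm 1 (-1), ← Real.cos_pi, ← Real.cos_zero, ← h,
      ← intervalIntegral.integral_neg]
    refine intervalIntegral.integral_congr fun x _ => ?_
    simp [mul_comm]
  rw [e, intervalIntegral.integral_of_le (by norm_num), ← integral_gaussian]
  exact setIntegral_le_integral (integrable_exp_neg_mul_sq hb)
    (Eventually.of_forall fun x => (Real.exp_pos _).le)

/-- The bound on `stehfestCore` is integrated over `θ`. The factor `|y - 1/2|` compensates the
singularity `1 / √(1 - a)`, and one remaining `sin θ` allows the substitution `x = cos θ` into a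
Gaussian integral of size `m ^ (-1/2)`. -/
theorem exists_abs_stehfestPoly_le_gaussian : ∃ C : ℝ, 0 < C ∧ ∀ m : ℕ, 1 ≤ m → ∀ y : ℝ, 0 < y → y < 1 →
    |y - 1 / 2| * |stehfestPoly (m + 1) y| ≤
      C * (y * (1 - y)) * (√m * Real.exp (-(2 * m / 5) * (y - 1 / 2) ^ 2)) := by
  refine ⟨4 * Real.exp √2 * √(10 * Real.pi) / Real.pi, by positivity, fun m hm y hy0 hy1 => ?_⟩
  set z := y * (1 - y) with hz
  have hz0 : 0 < z := mul_pos hy0 (by linarith)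
  rcases eq_or_ne y (1 / 2) with h | hne
  · rw [h, sub_self, abs_zero, zero_mul]; positivity
  set v := |y - 1 / 2| with hv
  have hv0 : 0 < v := abs_pos.2 (sub_ne_zero.2 hne)
  have hv2 : v ^ 2 = (y - 1 / 2) ^ 2 := sq_abs _
  have hzv : 4 * z = 1 - 4 * v ^ 2 := by rw [hv2, hz]; ring
  have hv1 : 4 * v ^ 2 ≤ 1 := by linarith
  have hm0 : (1 : ℝ) ≤ m := by exact_mod_cast hm
  set M := 2 * z * (m + 1) * Real.exp √2 * Real.exp (-(2 * m / 5) * v ^ 2) with hM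
  have hM0 : 0 ≤ M := by positivity
  have hpt : ∀ θ ∈ Set.Icc 0 Real.pi, ‖v * (4 * z * Real.sin θ ^ 2 *
        stehfestCore m (4 * z * Real.sin θ ^ 2))‖ ≤
        M * (Real.sin θ * Real.exp (-(m / 10) * Real.cos θ ^ 2)) := by
    intro θ hθ
    have hs0 : 0 ≤ Real.sin θ := Real.sin_nonneg_of_mem_Icc hθ
    have hsc := Real.sin_sq_add_cos_sq θ
    set s := Real.sin θ
    set c := Real.cos θ
    set A := 4 * z * s ^ 2 with hA
    have hA0 : 0 ≤ A := by positivity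
    -- This identity gives both the exponential decay in `c` and in `v`, and the inequality `2 v s ≤
    -- √(1 - A)` that removes the singular denominator.
    have e1 : 1 - A = c ^ 2 + 4 * v ^ 2 * s ^ 2 := by rw [hA, hzv]; linear_combination -hsc
    have hlow : (c ^ 2 + 4 * v ^ 2) / 2 ≤ 1 - A := by
      have : s ^ 2 = 1 - c ^ 2 := by linarith
      rw [e1, this]
      nlinarith [mul_nonneg (sq_nonneg c) (sub_nonneg.2 hv1), sq_nonneg v,
        mul_nonneg (sq_nonneg v) (sq_nonneg s)]
    have hA1 : A < 1 := by
      have : 0 < 4 * v ^ 2 := by positivity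
      nlinarith [sq_nonneg c]
    have hsq : v * s ≤ √(1 - A) / 2 := by
      rw [le_div_iff₀ two_pos]
      refine Real.le_sqrt_of_sq_le ?_
      rw [e1]; nlinarith [sq_nonneg c]
    have hpos : 0 < √(1 - A) := Real.sqrt_pos.2 (by linarith)
    have hcore := abs_stehfestCore_le m hA0 hA1
    rw [Real.norm_eq_abs, abs_mul, abs_mul, abs_of_pos hv0, abs_of_nonneg hA0]
    calc v * (A * |stehfestCore m A|)
        ≤ v * (A * ((m + 1) * Real.exp √2 / √(1 - A) * Real.exp (-(m * (1 - A) / 5)))) := by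
          gcongr
      _ = (v * s) * (4 * z * s * ((m + 1) * Real.exp √2 / √(1 - A)
            * Real.exp (-(m * (1 - A) / 5)))) := by rw [hA]; ring
      _ ≤ (√(1 - A) / 2) * (4 * z * s * ((m + 1) * Real.exp √2 / √(1 - A)
            * Real.exp (-(m * (1 - A) / 5)))) := by gcongr
      _ = 2 * z * s * (m + 1) * Real.exp √2 * Real.exp (-(m * (1 - A) / 5)) := by
          field_simp; ring
      _ ≤ 2 * z * s * (m + 1) * Real.exp √2 *
            (Real.exp (-(2 * m / 5) * v ^ 2) * Real.exp (-(m / 10) * c ^ 2)) := by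
          rw [← Real.exp_add]
          have : -(m * (1 - A) / 5) ≤ -(2 * m / 5) * v ^ 2 + -(m / 10) * c ^ 2 := by
            nlinarith
          gcongr
      _ = _ := by rw [hM]; ring
  have hint := intervalIntegral.norm_integral_le_of_norm_le Real.pi_pos.le
    (μ := volume) (f := fun θ => v * (4 * z * Real.sin θ ^ 2 *
        stehfestCore m (4 * z * Real.sin θ ^ 2)))
    (g := fun θ => M * (Real.sin θ * Real.exp (-(m / 10) * Real.cos θ ^ 2)))
    (Eventually.of_forall fun θ hθ => hpt θ (Set.Ioc_subset_Icc_self hθ))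
    (Continuous.intervalIntegrable (by fun_prop) _ _)
  rw [intervalIntegral.integral_const_mul, intervalIntegral.integral_const_mul,
    Real.norm_eq_abs, abs_mul, abs_of_pos hv0] at hint
  have hg := integral_sin_mul_exp_neg_cos_sq_le (b := (m : ℝ) / 10) (by positivity)
  rw [stehfestPoly_succ_eq_integral, abs_mul, abs_of_pos (by positivity)]
  have hsm : (m + 1) * √(Real.pi / (m / 10)) ≤ 2 * √(10 * Real.pi) * √m := by
    have : Real.pi / (m / 10) = (10 * Real.pi) / m := by field_simp
    rw [this, Real.sqrt_div (by positivity)]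
    have hms : 0 < √(m : ℝ) := Real.sqrt_pos.2 (by linarith)
    rw [← mul_div_assoc, div_le_iff₀ hms]
    have : √(m : ℝ) * √m = m := Real.mul_self_sqrt (by positivity)
    calc (m + 1) * √(10 * Real.pi) ≤ (2 * m) * √(10 * Real.pi) := by gcongr; linarith
      _ = _ := by rw [mul_assoc (2 * √(10 * Real.pi)), this]; ring
  calc v * (1 / Real.pi * |∫ θ in (0 : ℝ)..Real.pi, 4 * z * Real.sin θ ^ 2 *
        stehfestCore m (4 * z * Real.sin θ ^ 2)|)
      = 1 / Real.pi * (v * |∫ θ in (0 : ℝ)..Real.pi, 4 * z * Real.sin θ ^ 2 *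
        stehfestCore m (4 * z * Real.sin θ ^ 2)|) := by ring
    _ ≤ 1 / Real.pi * (M * √(Real.pi / (m / 10))) := by
        exact mul_le_mul_of_nonneg_left (hint.trans (mul_le_mul_of_nonneg_left hg hM0))
          (by positivity)
    _ = 2 * z * Real.exp √2 * Real.exp (-(2 * m / 5) * v ^ 2) / Real.pi *
          ((m + 1) * √(Real.pi / (m / 10))) := by rw [hM]; ring
    _ ≤ 2 * z * Real.exp √2 * Real.exp (-(2 * m / 5) * v ^ 2) / Real.pi *
          (2 * √(10 * Real.pi) * √m) := by gcongr
    _ = _ := by rw [hv2]; ring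

/-! ### Convergence of the Gaver–Stehfest inversion -/

theorem sq_mul_exp_neg_mul_sq_le {b : ℝ} (hb : 0 < b) (x : ℝ) :
    x ^ 2 * Real.exp (-b * x ^ 2) ≤ 2 / b * Real.exp (-(b / 2) * x ^ 2) := by
  have h := Real.add_one_le_exp (b / 2 * x ^ 2)
  have e : Real.exp (-(b / 2) * x ^ 2) = Real.exp (b / 2 * x ^ 2) * Real.exp (-b * x ^ 2) := by
    rw [← Real.exp_add]; congr 1; ring
  rw [e, ← mul_assoc]
  gcongr
  rw [div_mul_eq_mul_div, le_div_iff₀ hb]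
  linarith

/-- The Gaussian bound loses a factor `1 / |y - 1/2|`, so `D` has to vanish to second order in the
little-o sense: `D = o(|y - 1/2|)`. Growth of `D` at the endpoints is absorbed by the factor `y (1 -
y)` of the bound. -/
theorem tendsto_integral_stehfestPoly_mul {D : ℝ → ℝ} {C : ℝ} (hD : HasDerivAt D 0 (1 / 2))
    (hD0 : D (1 / 2) = 0) (hC : ∀ y ∈ Set.Ioo (0 : ℝ) 1, y * (1 - y) * |D y| ≤ C) :
    Tendsto (fun m : ℕ => ∫ y in Set.Ioo (0 : ℝ) 1, stehfestPoly (m + 1) y * D y)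
      atTop (𝓝 0) := by
  obtain ⟨C₁, hC₁, hker⟩ := exists_abs_stehfestPoly_le_gaussian
  have hC0 : 0 ≤ C := le_trans (by positivity) (hC (1 / 2) (by norm_num))
  have bound : ∀ ε > 0, ∃ K : ℝ, 0 ≤ K ∧ ∀ y ∈ Set.Ioo (0 : ℝ) 1,
      y * (1 - y) * |D y| ≤ |y - 1 / 2| * (ε + K * (y - 1 / 2) ^ 2) := by
    intro ε hε
    have h1 := (hasDerivAt_iff_isLittleO.1 hD).def hε
    rw [Metric.eventually_nhds_iff] at h1
    obtain ⟨δ, hδ, h1⟩ := h1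
    -- Within distance `δ` of `1/2` differentiability gives the `ε` term; farther away `|y - 1/2| ^
    -- 3 / δ ^ 3 ≥ 1` turns the bound `C` into the cubic term.
    refine ⟨C / δ ^ 3, by positivity, fun y hy => ?_⟩
    have hz : 0 < y * (1 - y) := mul_pos hy.1 (by linarith [hy.2])
    rcases lt_or_ge |y - 1 / 2| δ with h | h
    · have := h1 (y := y) (by rwa [Real.dist_eq])
      simp only [hD0, smul_zero, sub_zero, Real.norm_eq_abs] at this
      have hz1 : y * (1 - y) ≤ 1 := by nlinarith [sq_nonneg (y - 1 / 2)]
      calc y * (1 - y) * |D y| ≤ 1 * (ε * |y - 1 / 2|) := by gcongr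
        _ = |y - 1 / 2| * (ε + 0) := by ring
        _ ≤ _ := by gcongr; positivity
    · refine (hC y hy).trans ?_
      have h3 : δ ^ 3 ≤ |y - 1 / 2| ^ 3 := by gcongr
      calc C = C / δ ^ 3 * δ ^ 3 := by field_simp
        _ ≤ C / δ ^ 3 * |y - 1 / 2| ^ 3 := by gcongr
        _ = |y - 1 / 2| * (0 + C / δ ^ 3 * (y - 1 / 2) ^ 2) := by
          rw [← sq_abs (y - 1 / 2)]; ring
        _ ≤ _ := by gcongr
  rw [Metric.tendsto_atTop]
  intro ε hε
  set q := √(5 * Real.pi / 2) with hq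
  have hq0 : 0 < q := by positivity
  obtain ⟨K, hK0, hK⟩ := bound (ε / (2 * (C₁ * q))) (by positivity)
  set ε' := ε / (2 * (C₁ * q)) with hε'
  have hlim : Tendsto (fun m : ℕ => C₁ * K * 5 * √(5 * Real.pi) / (m : ℝ)) atTop (𝓝 0) :=
    tendsto_const_div_atTop_nhds_zero_nat _
  obtain ⟨N, hN⟩ := (Metric.tendsto_atTop.1 hlim) (ε / 2) (by positivity)
  refine ⟨max N 1, fun m hm => ?_⟩
  have hm1 : 1 ≤ m := (le_max_right _ _).trans hm
  have hm0 : (0 : ℝ) < m := by exact_mod_cast hm1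
  have hNm := hN m ((le_max_left _ _).trans hm)
  rw [Real.dist_eq, sub_zero] at hNm
  have hb : (0 : ℝ) < 2 * m / 5 := by positivity
  set g : ℝ → ℝ := fun x => C₁ * √m * (ε' * Real.exp (-(2 * m / 5) * x ^ 2) +
    K * (2 / (2 * m / 5) * Real.exp (-(2 * m / 5 / 2) * x ^ 2))) with hg
  have hgi : Integrable g := by
    refine Integrable.const_mul (Integrable.add ?_ ?_) _
    · exact (integrable_exp_neg_mul_sq hb).const_mul _
    · exact ((integrable_exp_neg_mul_sq (half_pos hb)).const_mul _).const_mul _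
  have hgval : ∫ x, g x = C₁ * ε' * q + C₁ * K * 5 * √(5 * Real.pi) / m := by
    rw [hg, integral_const_mul, integral_add, integral_const_mul, integral_const_mul,
      integral_const_mul, integral_gaussian, integral_gaussian]
    · have e1 : Real.pi / (2 * m / 5) = (5 * Real.pi / 2) / m := by field_simp
      have e2 : Real.pi / (2 * m / 5 / 2) = (5 * Real.pi) / m := by field_simp
      rw [e1, e2, Real.sqrt_div (show 0 ≤ 5 * Real.pi / 2 by positivity) (m : ℝ),
        Real.sqrt_div (show 0 ≤ 5 * Real.pi by positivity) (m : ℝ), ← hq]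
      have : √(m : ℝ) ≠ 0 := (Real.sqrt_pos.2 hm0).ne'
      field_simp
    · exact (integrable_exp_neg_mul_sq hb).const_mul _
    · exact ((integrable_exp_neg_mul_sq (half_pos hb)).const_mul _).const_mul _
  have hpt : ∀ y ∈ Set.Ioo (0 : ℝ) 1, y ≠ 1 / 2 →
      ‖stehfestPoly (m + 1) y * D y‖ ≤ g (y - 1 / 2) := by
    intro y hy hne
    have hv : 0 < |y - 1 / 2| := abs_pos.2 (sub_ne_zero.2 hne)
    have hz : 0 < y * (1 - y) := mul_pos hy.1 (by linarith [hy.2])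
    have h1 := hker m hm1 y hy.1 hy.2
    have h2 := hK y hy
    have h3 := sq_mul_exp_neg_mul_sq_le hb (y - 1 / 2)
    rw [Real.norm_eq_abs, abs_mul]
    refine le_of_mul_le_mul_left ?_ hv
    set E := Real.exp (-(2 * m / 5) * (y - 1 / 2) ^ 2)
    calc |y - 1 / 2| * (|stehfestPoly (m + 1) y| * |D y|)
        = (|y - 1 / 2| * |stehfestPoly (m + 1) y|) * |D y| := by ring
      _ ≤ (C₁ * (y * (1 - y)) * (√m * E)) * |D y| := by gcongr
      _ = C₁ * √m * E * (y * (1 - y) * |D y|) := by ring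
      _ ≤ C₁ * √m * E * (|y - 1 / 2| * (ε' + K * (y - 1 / 2) ^ 2)) := by gcongr
      _ = |y - 1 / 2| * (C₁ * √m * (ε' * E + K * ((y - 1 / 2) ^ 2 * E))) := by ring
      _ ≤ _ := by simp only [hg]; gcongr
  have hae : ∀ᵐ y : ℝ, y ≠ 1 / 2 := by
    simp [ae_iff, measure_singleton]
  have hgi' : Integrable (fun y => g (y - 1 / 2)) := hgi.comp_sub_right _
  have hle : ‖∫ y in Set.Ioo (0 : ℝ) 1, stehfestPoly (m + 1) y * D y‖
      ≤ ∫ y in Set.Ioo (0 : ℝ) 1, g (y - 1 / 2) := by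
    refine norm_integral_le_of_norm_le hgi'.integrableOn ?_
    rw [ae_restrict_iff' measurableSet_Ioo]
    filter_upwards [hae] with y hy hy2 using hpt y hy2 hy
  have hle2 : ∫ y in Set.Ioo (0 : ℝ) 1, g (y - 1 / 2) ≤ ∫ y, g (y - 1 / 2) :=
    setIntegral_le_integral hgi' (Eventually.of_forall fun y => by
      simp only [hg, Pi.zero_apply]; positivity)
  rw [integral_sub_right_eq_self (μ := volume) g (1 / 2), hgval] at hle2
  rw [dist_zero_right]
  have e3 : C₁ * ε' * q = ε / 2 := by rw [hε']; field_simp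
  have := le_abs_self (C₁ * K * 5 * √(5 * Real.pi) / (m : ℝ))
  linarith

theorem continuous_stehfestPoly (n : ℕ) : Continuous (stehfestPoly n) := by
  unfold stehfestPoly; fun_prop

theorem stehfestPoly_one_sub (n : ℕ) (y : ℝ) : stehfestPoly n (1 - y) = stehfestPoly n y := by
  rw [stehfestPoly_eq, stehfestPoly_eq]
  simp [mul_comm]

theorem abs_stehfestPoly_le (n : ℕ) {y : ℝ} (h0 : 0 ≤ y) (h1 : y ≤ 1) :
    |stehfestPoly n y| ≤ (∑ k ∈ Finset.Icc 1 (2 * n), |weight (2 * n) k|) * y := by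
  rw [stehfestPoly, Finset.sum_mul]
  refine (Finset.abs_sum_le_sum_abs _ _).trans (Finset.sum_le_sum fun k hk => ?_)
  rw [abs_mul, abs_of_nonneg (pow_nonneg h0 k)]
  have : y ^ k ≤ y := pow_le_of_le_one h0 h1 (by have := (Finset.mem_Icc.1 hk).1; omega)
  gcongr

theorem integral_Ioi_eq_integral_Ioo_log {h : ℝ → ℝ} {b : ℝ} (hb : 0 < b) :
    ∫ u in Set.Ioi (0 : ℝ), h u
      = ∫ y in Set.Ioo (0 : ℝ) 1, 1 / (b * y) * h (-(Real.log y / b)) := by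
  have himg : (fun y : ℝ => -(Real.log y / b)) '' Set.Ioo 0 1 = Set.Ioi 0 := by
    ext u
    simp only [Set.mem_image, Set.mem_Ioo, Set.mem_Ioi]
    constructor
    · rintro ⟨y, ⟨h0, h1⟩, rfl⟩
      have := Real.log_neg h0 h1
      rw [← neg_div]
      exact div_pos (by linarith) hb
    · intro hu
      refine ⟨Real.exp (-(b * u)), ⟨Real.exp_pos _, ?_⟩, ?_⟩
      · rw [Real.exp_lt_one_iff]; have := mul_pos hb hu; linarith
      · rw [Real.log_exp]; field_simp
  rw [← himg, integral_image_eq_integral_abs_deriv_smul (f' := fun y => -(1 / (b * y)))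
    measurableSet_Ioo]
  · refine setIntegral_congr_fun measurableSet_Ioo fun y hy => ?_
    have : 0 < 1 / (b * y) := by have := hy.1; positivity
    simp only [smul_eq_mul, abs_neg, abs_of_pos this]
  · intro y hy
    have := ((Real.hasDerivAt_log hy.1.ne').div_const b).neg
    refine (this.congr_deriv ?_).hasDerivWithinAt
    have := hy.1.ne'
    field_simp
  · intro x hx y hy hxy
    simp only [neg_inj] at hxy
    have : Real.log x = Real.log y := by
      field_simp at hxy; exact hxy
    exact Real.log_injOn_pos hx.1 hy.1 this

/-- Convergence of the Gaver–Stehfest inversion at a point of differentiability. -/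
theorem tendsto_integral_stehfestPoly_exp {G : ℝ → ℝ} {C : ℝ} (hG : Measurable G)
    (hC : ∀ u, 0 < u → |G u| ≤ C) (hd : DifferentiableAt ℝ G 1) :
    Tendsto (fun m : ℕ => ∫ u in Set.Ioi (0 : ℝ),
      Real.log 2 * stehfestPoly (m + 1) (Real.exp (-(Real.log 2 * u))) * G u)
      atTop (𝓝 (G 1)) := by
  have hl : 0 < Real.log 2 := Real.log_pos one_lt_two
  set τ : ℝ → ℝ := fun y => -(Real.log y / Real.log 2) with hτ
  have hτm : Measurable τ := by fun_prop
  have hτ2 : τ (1 / 2) = 1 := by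
    simp only [hτ]; rw [one_div, Real.log_inv]; field_simp
  have hτpos : ∀ y ∈ Set.Ioo (0 : ℝ) 1, 0 < τ y := fun y hy => by
    simp only [hτ]; rw [← neg_div]
    exact div_pos (by linarith [Real.log_neg hy.1 hy.2]) hl
  have hC0 : 0 ≤ C := (abs_nonneg _).trans (hC 1 one_pos)
  -- With `y = 2 ^ (-u)` the measure `log 2 du` becomes `dy / y`, so `κ` is the error `G u - G 1`
  -- together with this density.
  set κ : ℝ → ℝ := fun y => (G (τ y) - G 1) / y with hκ
  have hκm : Measurable κ := ((hG.comp hτm).sub_const _).div measurable_id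
  have hκb : ∀ y ∈ Set.Ioo (0 : ℝ) 1, |κ y| ≤ 2 * C / y := fun y hy => by
    simp only [hκ]
    rw [abs_div, abs_of_pos hy.1]
    have h1 := hC _ (hτpos y hy)
    have h2 := hC 1 one_pos
    have h3 := abs_sub (G (τ y)) (G 1)
    have := hy.1
    gcongr
    linarith
  have hκd : ∃ k, HasDerivAt κ k (1 / 2) := by
    have h1 : DifferentiableAt ℝ τ (1 / 2) := by
      simp only [hτ]
      exact ((Real.differentiableAt_log (by norm_num)).div_const _).neg
    have h2 : DifferentiableAt ℝ (fun y => G (τ y)) (1 / 2) :=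
      DifferentiableAt.comp (1 / 2 : ℝ) (by rw [hτ2]; exact hd) h1
    exact ⟨_, ((h2.sub_const (G 1)).div differentiableAt_id (by norm_num)).hasDerivAt⟩
  obtain ⟨k, hk⟩ := hκd
  have hκ0 : κ (1 / 2) = 0 := by simp only [hκ]; rw [hτ2]; simp
  -- Symmetrising cancels the derivative at `1/2`. The kernel is symmetric, so the integral of the
  -- symmetrised function is twice that of `κ`.
  have hDd : HasDerivAt (fun y => κ y + κ (1 - y)) 0 (1 / 2) := by
    have h1 : HasDerivAt (fun y => κ (1 - y)) (k * -1) (1 / 2) := by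
      refine HasDerivAt.comp (1 / 2 : ℝ) (h₂ := κ) (h := fun y => 1 - y) ?_ ?_
      · norm_num; simpa using hk
      · simpa using (hasDerivAt_id (1 / 2 : ℝ)).const_sub 1
    exact (hk.add h1).congr_deriv (by ring)
  have hlim := tendsto_integral_stehfestPoly_mul (C := 2 * C) hDd
    (by norm_num; simpa using hκ0) (fun y hy => by
      have hy1 : 0 < 1 - y := by linarith [hy.2]
      have hy0 := hy.1
      have h1 := hκb y hy
      have h2 := hκb (1 - y) ⟨hy1, by linarith⟩
      calc y * (1 - y) * |κ y + κ (1 - y)|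
          ≤ y * (1 - y) * (2 * C / y + 2 * C / (1 - y)) := by
            gcongr; exact (abs_add_le _ _).trans (add_le_add h1 h2)
        _ = 2 * C := by field_simp; ring)
  have hval : ∀ m : ℕ, ∫ u in Set.Ioi (0 : ℝ),
      Real.log 2 * stehfestPoly (m + 1) (Real.exp (-(Real.log 2 * u))) * G u
      = G 1 + (∫ y in Set.Ioo (0 : ℝ) 1, stehfestPoly (m + 1) y * (κ y + κ (1 - y))) / 2 := by
    intro m
    set W := ∑ k ∈ Finset.Icc 1 (2 * (m + 1)), |weight (2 * (m + 1)) k| with hW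
    have hW0 : 0 ≤ W := Finset.sum_nonneg fun _ _ => abs_nonneg _
    have hPm : Measurable (stehfestPoly (m + 1)) := (continuous_stehfestPoly _).measurable
    have hI1 : IntegrableOn (fun y => stehfestPoly (m + 1) y * κ y) (Set.Ioo (0 : ℝ) 1) := by
      refine Integrable.mono' (g := fun _ => W * (2 * C))
        (integrableOn_const (by simp)) (hPm.mul hκm).aestronglyMeasurable ?_
      rw [ae_restrict_iff' measurableSet_Ioo]
      refine Eventually.of_forall fun y hy => ?_
      have hy0 := hy.1
      rw [Real.norm_eq_abs, abs_mul]
      calc |stehfestPoly (m + 1) y| * |κ y| ≤ (W * y) * (2 * C / y) := by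
            gcongr
            · exact abs_stehfestPoly_le _ hy.1.le hy.2.le
            · exact hκb y hy
        _ = W * (2 * C) := by field_simp
    have hI2 : IntegrableOn (fun y => stehfestPoly (m + 1) y / y) (Set.Ioo (0 : ℝ) 1) := by
      refine Integrable.mono' (g := fun _ => W)
        (integrableOn_const (by simp)) (hPm.div measurable_id).aestronglyMeasurable ?_
      rw [ae_restrict_iff' measurableSet_Ioo]
      refine Eventually.of_forall fun y hy => ?_
      rw [Real.norm_eq_abs, abs_div, abs_of_pos hy.1, div_le_iff₀ hy.1]
      exact abs_stehfestPoly_le _ hy.1.le hy.2.le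
    have hsymm : ∫ y in Set.Ioo (0 : ℝ) 1, stehfestPoly (m + 1) y * κ (1 - y)
        = ∫ y in Set.Ioo (0 : ℝ) 1, stehfestPoly (m + 1) y * κ y := by
      rw [← integral_Ioc_eq_integral_Ioo, ← integral_Ioc_eq_integral_Ioo,
        ← intervalIntegral.integral_of_le zero_le_one, ← intervalIntegral.integral_of_le zero_le_one]
      have := intervalIntegral.integral_comp_sub_left (a := 0) (b := 1)
        (fun y => stehfestPoly (m + 1) y * κ y) 1
      simp only [stehfestPoly_one_sub, sub_self, sub_zero] at this
      exact this
    have hI3 : IntegrableOn (fun y => stehfestPoly (m + 1) y * κ (1 - y)) (Set.Ioo (0 : ℝ) 1) := by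
      rw [← intervalIntegrable_iff_integrableOn_Ioo_of_le zero_le_one] at hI1 ⊢
      have := (hI1.comp_sub_left 1).symm
      simpa [stehfestPoly_one_sub] using this
    have hnorm : ∫ y in Set.Ioo (0 : ℝ) 1, stehfestPoly (m + 1) y / y = 1 := by
      rw [← integral_Ioc_eq_integral_Ioo, ← intervalIntegral.integral_of_le zero_le_one,
        integral_stehfestPoly_div]
    simp_rw [mul_add]
    rw [integral_add hI1 hI3, hsymm, integral_Ioi_eq_integral_Ioo_log hl, add_self_div_two]
    calc _ = ∫ y in Set.Ioo (0 : ℝ) 1,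
          (G 1 * (stehfestPoly (m + 1) y / y) + stehfestPoly (m + 1) y * κ y) := by
          refine setIntegral_congr_fun measurableSet_Ioo fun y hy => ?_
          have hy0 := hy.1.ne'
          have he : Real.exp (-(Real.log 2 * -(Real.log y / Real.log 2))) = y := by
            rw [show -(Real.log 2 * -(Real.log y / Real.log 2)) = Real.log y by field_simp,
              Real.exp_log hy.1]
          simp only [he, hκ, hτ]
          field_simp
          ring
      _ = _ := by rw [integral_add (hI2.const_mul _) hI1, integral_const_mul, hnorm, mul_one]
  simp_rw [hval]
  simpa using (hlim.div_const 2).const_add (G 1)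

/-! ### Midpoint sums on `[0, π]` -/

/-- The midpoint of the cell containing `x` in the partition of `[0, π]` into `N` equal cells. -/
noncomputable def cellMidpoint (N : ℕ) (x : ℝ) : ℝ :=
  (2 * ((⌊N * x / Real.pi⌋ : ℝ) + 1) - 1) / (2 * N) * Real.pi

theorem cellMidpoint_mem {N : ℕ} (hN : 0 < N) {x : ℝ} (hx : x ∈ Set.Ioo 0 Real.pi) :
    cellMidpoint N x ∈ Set.Ioo 0 Real.pi := by
  have hN' : (0 : ℝ) < N := by exact_mod_cast hN
  have hpi := Real.pi_pos
  have h0 : 0 ≤ ⌊N * x / Real.pi⌋ := Int.floor_nonneg.2 (by have := hx.1; positivity)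
  have h1 : ⌊N * x / Real.pi⌋ < N := by
    rw [Int.floor_lt, div_lt_iff₀ hpi]
    exact mul_lt_mul_of_pos_left hx.2 hN'
  have h0' : (0 : ℝ) ≤ ⌊N * x / Real.pi⌋ := by exact_mod_cast h0
  have h1' : (⌊N * x / Real.pi⌋ : ℝ) + 1 ≤ N := by exact_mod_cast h1
  rw [cellMidpoint]
  constructor
  · apply mul_pos (div_pos (by linarith) (by positivity)) hpi
  · rw [div_mul_eq_mul_div, div_lt_iff₀ (by positivity)]
    nlinarith

theorem abs_cellMidpoint_sub_le {N : ℕ} (hN : 0 < N) (x : ℝ) :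
    |cellMidpoint N x - x| ≤ Real.pi / N := by
  have hN' : (0 : ℝ) < N := by exact_mod_cast hN
  have hpi := Real.pi_pos
  have h1 := Int.floor_le (N * x / Real.pi)
  have h2 := Int.lt_floor_add_one (N * x / Real.pi)
  have e : cellMidpoint N x - x = Real.pi / N * ((⌊N * x / Real.pi⌋ : ℝ) + 1 / 2 - N * x / Real.pi) := by
    rw [cellMidpoint]; field_simp; ring
  rw [e, abs_mul, abs_of_pos (by positivity)]
  refine mul_le_of_le_one_right (by positivity) ?_
  rw [abs_le]; constructor <;> linarith

theorem measurable_comp_cellMidpoint (N : ℕ) (f : ℝ → ℝ) :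
    Measurable fun x => f (cellMidpoint N x) := by
  have : (fun x => f (cellMidpoint N x)) =
      (fun k : ℤ => f ((2 * ((k : ℝ) + 1) - 1) / (2 * N) * Real.pi)) ∘
        fun x => ⌊N * x / Real.pi⌋ := rfl
  rw [this]
  exact (measurable_from_top).comp (Int.measurable_floor.comp (by fun_prop))

theorem sum_midpoint_eq_integral {N : ℕ} (hN : 0 < N) (f : ℝ → ℝ) :
    Real.pi / N * ∑ i : Fin N, f ((2 * ((i : ℝ) + 1) - 1) / (2 * N) * Real.pi)
      = ∫ x in (0 : ℝ)..Real.pi, f (cellMidpoint N x) := by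
  have hN' : (0 : ℝ) < N := by exact_mod_cast hN
  have hpi := Real.pi_pos
  set a : ℕ → ℝ := fun i => i * (Real.pi / N) with ha
  have hcell : ∀ i : ℕ, ∀ x ∈ Set.Ioo (a i) (a (i + 1)),
      f (cellMidpoint N x) = f ((2 * ((i : ℝ) + 1) - 1) / (2 * N) * Real.pi) := by
    intro i x hx
    have : ⌊N * x / Real.pi⌋ = (i : ℤ) := by
      rw [Int.floor_eq_iff]
      have h1 := hx.1
      have h2 := hx.2
      simp only [ha] at h1 h2
      push_cast at h1 h2 ⊢
      constructor
      · rw [le_div_iff₀ hpi]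
        have : (i : ℝ) * Real.pi = N * (i * (Real.pi / N)) := by field_simp
        rw [this]; gcongr
      · rw [div_lt_iff₀ hpi]
        have : ((i : ℝ) + 1) * Real.pi = N * ((i + 1) * (Real.pi / N)) := by field_simp
        rw [this]; gcongr
    rw [cellMidpoint, this]; simp
  have hle : ∀ i : ℕ, a i ≤ a (i + 1) := fun i => by
    simp only [ha]; push_cast; gcongr; linarith
  have hae : ∀ i : ℕ, ∀ᵐ x : ℝ, x ∈ Set.uIoc (a i) (a (i + 1)) →
      f (cellMidpoint N x) = f ((2 * ((i : ℝ) + 1) - 1) / (2 * N) * Real.pi) := by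
    intro i
    have hne : ∀ᵐ x : ℝ, x ≠ a (i + 1) := by simp [ae_iff, measure_singleton]
    filter_upwards [hne] with x hx hmem
    rw [Set.uIoc_of_le (hle i)] at hmem
    exact hcell i x ⟨hmem.1, lt_of_le_of_ne hmem.2 hx⟩
  have hint : ∀ i < N, IntervalIntegrable (fun x => f (cellMidpoint N x)) volume (a i) (a (i + 1)) := by
    intro i _
    exact (intervalIntegrable_congr_ae ((ae_restrict_iff' measurableSet_uIoc).2 (hae i))).2
      intervalIntegrable_const
  have h := intervalIntegral.sum_integral_adjacent_intervals hint
  have h0 : a 0 = 0 := by simp [ha]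
  have h1 : a N = Real.pi := by simp only [ha]; field_simp
  rw [h0, h1] at h
  rw [← h, ← Fin.sum_univ_eq_sum_range
    (fun i => ∫ x in a i..a (i + 1), f (cellMidpoint N x)) N, Finset.mul_sum]
  refine Finset.sum_congr rfl fun i _ => ?_
  rw [intervalIntegral.integral_congr_ae (hae i), intervalIntegral.integral_const, smul_eq_mul]
  congr 1
  simp only [ha]; push_cast; ring

/-- Midpoint sums of uniformly bounded, continuously convergent integrands converge. -/
theorem tendsto_sum_midpoint {ι : Type*} {l : Filter ι} [l.IsCountablyGenerated] {n : ι → ℕ}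
    (hn : Tendsto n l atTop) {f : ι → ℝ → ℝ} {f₀ : ℝ → ℝ} {C : ℝ}
    (hC : ∀ᶠ i in l, ∀ x ∈ Set.Ioo 0 Real.pi, |f i x| ≤ C)
    (hf : ∀ x ∈ Set.Ioo 0 Real.pi,
      Tendsto (fun p : ι × ℝ => f p.1 p.2) (l ×ˢ 𝓝 x) (𝓝 (f₀ x))) :
    Tendsto (fun i => Real.pi / n i *
        ∑ j : Fin (n i), f i ((2 * ((j : ℝ) + 1) - 1) / (2 * n i) * Real.pi))
      l (𝓝 (∫ x in (0 : ℝ)..Real.pi, f₀ x)) := by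
  have hpos : ∀ᶠ i in l, 0 < n i := hn.eventually_gt_atTop 0
  have hne : ∀ᵐ x : ℝ, x ≠ Real.pi := by simp [ae_iff, measure_singleton]
  have key : Tendsto (fun i => ∫ x in (0 : ℝ)..Real.pi, f i (cellMidpoint (n i) x)) l
      (𝓝 (∫ x in (0 : ℝ)..Real.pi, f₀ x)) := by
    refine intervalIntegral.tendsto_integral_filter_of_dominated_convergence (fun _ => C)
      (Eventually.of_forall fun i => (measurable_comp_cellMidpoint _ _).aestronglyMeasurable)
      ?_ intervalIntegrable_const ?_
    · filter_upwards [hC, hpos] with i hi hi2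
      filter_upwards [hne] with x hx hmem
      rw [Set.uIoc_of_le Real.pi_pos.le] at hmem
      exact hi _ (cellMidpoint_mem hi2 ⟨hmem.1, lt_of_le_of_ne hmem.2 hx⟩)
    · filter_upwards [hne] with x hx hmem
      rw [Set.uIoc_of_le Real.pi_pos.le] at hmem
      -- The evaluation point moves together with the integrand, which is why convergence is assumed
      -- along `l ×ˢ 𝓝 x`.
      refine (hf x ⟨hmem.1, lt_of_le_of_ne hmem.2 hx⟩).comp (tendsto_id.prodMk ?_)
      rw [tendsto_iff_dist_tendsto_zero]
      refine squeeze_zero' (Eventually.of_forall fun _ => dist_nonneg)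
        (hpos.mono fun i hi => (abs_cellMidpoint_sub_le hi x)) ?_
      exact (tendsto_const_nhds.div_atTop (tendsto_natCast_atTop_atTop.comp hn))
  refine key.congr' ?_
  filter_upwards [hpos] with i hi
  exact (sum_midpoint_eq_integral hi (f i)).symm

/-! ### Angular Laplace kernel and its Chebyshev sums -/

/-- The integrand of the Laplace transform at `s` of the law of `β X / (X + K)`, `X` standard
exponential, in the angular variable `φ` with `X = K (1 + cos φ) / (1 - cos φ)`. -/
noncomputable def laplaceKernel (K β s φ : ℝ) : ℝ :=
  2 * K * Real.sin φ / (1 - Real.cos φ) ^ 2 *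
    Real.exp (-(K * (1 + Real.cos φ) / (1 - Real.cos φ))) *
    Real.exp (-(s * (β * (1 + Real.cos φ) / 2)))

theorem cos_mem_Ioo {φ : ℝ} (hφ : φ ∈ Set.Ioo 0 Real.pi) : Real.cos φ ∈ Set.Ioo (-1 : ℝ) 1 := by
  constructor
  · rw [← Real.cos_pi]
    exact Real.cos_lt_cos_of_nonneg_of_le_pi hφ.1.le le_rfl hφ.2
  · rw [← Real.cos_zero]
    exact Real.cos_lt_cos_of_nonneg_of_le_pi le_rfl hφ.2.le hφ.1

theorem laplaceKernel_nonneg {K β s φ : ℝ} (hK : 0 < K) (hφ : φ ∈ Set.Ioo 0 Real.pi) :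
    0 ≤ laplaceKernel K β s φ := by
  have := Real.sin_pos_of_mem_Ioo hφ
  unfold laplaceKernel
  positivity

theorem sq_mul_exp_neg_le {K w : ℝ} (hK : 0 < K) (hw : 0 ≤ w) :
    w ^ 2 * Real.exp (-(2 * K * w)) ≤ 1 / (2 * K ^ 2) := by
  have h := Real.quadratic_le_exp_of_nonneg (x := 2 * K * w) (by positivity)
  rw [Real.exp_neg, ← div_eq_mul_inv, div_le_div_iff₀ (Real.exp_pos _) (by positivity)]
  nlinarith [mul_nonneg hK.le hw]

/-- With `w = 1 / (1 - cos φ)` the first exponential is `e ^ K e ^ (-2 K w)`, whose decay dominates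
the singular factor `w²` at `φ = 0`. -/
theorem laplaceKernel_le_sin {K β s φ : ℝ} (hK : 0 < K) (hφ : φ ∈ Set.Ioo 0 Real.pi) :
    laplaceKernel K β s φ ≤ Real.exp K / K * Real.sin φ *
      Real.exp (-(s * (β * (1 + Real.cos φ) / 2))) := by
  have hs := Real.sin_pos_of_mem_Ioo hφ
  have hc : 0 < 1 - Real.cos φ := by linarith [(cos_mem_Ioo hφ).2]
  have h := sq_mul_exp_neg_le (w := 1 / (1 - Real.cos φ)) hK (by positivity)
  have e : Real.exp (-(K * (1 + Real.cos φ) / (1 - Real.cos φ)))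
      = Real.exp K * Real.exp (-(2 * K * (1 / (1 - Real.cos φ)))) := by
    rw [← Real.exp_add]; congr 1; field_simp; ring
  unfold laplaceKernel
  refine mul_le_mul_of_nonneg_right ?_ (Real.exp_pos _).le
  rw [e]
  calc 2 * K * Real.sin φ / (1 - Real.cos φ) ^ 2 *
        (Real.exp K * Real.exp (-(2 * K * (1 / (1 - Real.cos φ)))))
      = 2 * K * Real.sin φ * Real.exp K * ((1 / (1 - Real.cos φ)) ^ 2
        * Real.exp (-(2 * K * (1 / (1 - Real.cos φ))))) := by field_simp
    _ ≤ 2 * K * Real.sin φ * Real.exp K * (1 / (2 * K ^ 2)) := by gcongr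
    _ = _ := by field_simp

theorem laplaceKernel_le {K β s φ : ℝ} (hK : 0 < K) (hβ : 0 < β) (hs : 0 ≤ s)
    (hφ : φ ∈ Set.Ioo 0 Real.pi) : laplaceKernel K β s φ ≤ Real.exp K / K := by
  have h0 := Real.sin_pos_of_mem_Ioo hφ
  have hc : 0 < 1 + Real.cos φ := by linarith [(cos_mem_Ioo hφ).1]
  calc laplaceKernel K β s φ ≤ _ := laplaceKernel_le_sin hK hφ
    _ ≤ Real.exp K / K * 1 * 1 := by
        gcongr
        · exact Real.sin_le_one φ
        · rw [Real.exp_le_one_iff]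
          have : 0 ≤ s * (β * (1 + Real.cos φ) / 2) := by positivity
          linarith
    _ = _ := by ring

/-- A pointwise decay in `s`, hence inherited by every quadrature sum uniformly in `N`. It rests on
`sin² φ ≤ 2 (1 + cos φ)` and on the boundedness of `X e ^ (-2X)`. -/
theorem laplaceKernel_mul_sqrt_le {K β s φ : ℝ} (hK : 0 < K) (hβ : 0 < β) (hs : 0 < s)
    (hφ : φ ∈ Set.Ioo 0 Real.pi) :
    laplaceKernel K β s φ * √s ≤ Real.exp K / K * (2 / √β) := by
  have h0 := Real.sin_pos_of_mem_Ioo hφ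
  have hc : 0 < 1 + Real.cos φ := by linarith [(cos_mem_Ioo hφ).1]
  have hc1 := (cos_mem_Ioo hφ).2
  have hJ := laplaceKernel_nonneg (β := β) (s := s) hK hφ
  set X := s * (β * (1 + Real.cos φ) / 2) with hX
  have hX0 : 0 < X := by positivity
  have hsin : Real.sin φ ^ 2 ≤ 2 * (1 + Real.cos φ) := by
    rw [Real.sin_sq]; nlinarith
  have hexp : X * Real.exp (-X) ^ 2 ≤ 1 := by
    have h1 := Real.add_one_le_exp X
    have h2 : Real.exp (-X) ≤ 1 := by rw [Real.exp_le_one_iff]; linarith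
    have h3 : Real.exp X * Real.exp (-X) = 1 := by rw [← Real.exp_add]; simp
    nlinarith [Real.exp_pos (-X)]
  refine le_of_sq_le_sq ?_ (by positivity)
  calc (laplaceKernel K β s φ * √s) ^ 2
      ≤ (Real.exp K / K * Real.sin φ * Real.exp (-X) * √s) ^ 2 := by
        gcongr; exact laplaceKernel_le_sin hK hφ
    _ = (Real.exp K / K) ^ 2 * Real.exp (-X) ^ 2 * s * Real.sin φ ^ 2 := by
        rw [mul_pow, mul_pow, mul_pow, Real.sq_sqrt hs.le]; ring
    _ ≤ (Real.exp K / K) ^ 2 * Real.exp (-X) ^ 2 * s * (2 * (1 + Real.cos φ)) := by gcongr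
    _ = (Real.exp K / K) ^ 2 * (4 / β) * (X * Real.exp (-X) ^ 2) := by
        rw [hX]; field_simp; ring
    _ ≤ (Real.exp K / K) ^ 2 * (4 / β) * 1 := by gcongr
    _ = _ := by rw [mul_pow, div_pow 2, Real.sq_sqrt hβ.le]; ring

theorem continuousAt_laplaceKernel (K β s : ℝ) {φ : ℝ} (hφ : φ ∈ Set.Ioo 0 Real.pi) :
    ContinuousAt (fun p : ℝ × ℝ => laplaceKernel K β p.1 p.2) (s, φ) := by
  have hc : 1 - Real.cos φ ≠ 0 := by linarith [(cos_mem_Ioo hφ).2]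
  unfold laplaceKernel
  refine ContinuousAt.mul (ContinuousAt.mul (ContinuousAt.div ?_ ?_ ?_) ?_) ?_
  · fun_prop
  · fun_prop
  · simpa using hc
  · refine Real.continuous_exp.continuousAt.comp (ContinuousAt.neg (ContinuousAt.div ?_ ?_ ?_))
    · fun_prop
    · fun_prop
    · simpa using hc
  · fun_prop

/-- The Laplace transform of the single-round SINR. -/
noncomputable def laplaceSinr (K β s : ℝ) : ℝ := ∫ φ in (0 : ℝ)..Real.pi, laplaceKernel K β s φ

theorem laplaceSinr_nonneg {K β s : ℝ} (hK : 0 < K) : 0 ≤ laplaceSinr K β s := by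
  rw [laplaceSinr, intervalIntegral.integral_of_le Real.pi_pos.le, integral_Ioc_eq_integral_Ioo]
  exact setIntegral_nonneg measurableSet_Ioo fun φ hφ => laplaceKernel_nonneg hK hφ

/-- The `N`-point Chebyshev–Gauss approximation of `laplaceSinr`. -/
noncomputable def laplaceSum (K β : ℝ) (N : ℕ) (s : ℝ) : ℝ :=
  Real.pi / N * ∑ i : Fin N, laplaceKernel K β s ((2 * ((i : ℝ) + 1) - 1) / (2 * N) * Real.pi)

theorem nodeAngle_mem {N : ℕ} (i : Fin N) :
    (2 * ((i : ℝ) + 1) - 1) / (2 * N) * Real.pi ∈ Set.Ioo 0 Real.pi := by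
  have hN : (0 : ℝ) < N := by exact_mod_cast i.pos
  have hi : (i : ℝ) + 1 ≤ N := by exact_mod_cast i.2
  have hi0 : (0 : ℝ) ≤ (i : ℝ) := by positivity
  have hpi := Real.pi_pos
  constructor
  · apply mul_pos (div_pos (by linarith) (by positivity)) hpi
  · rw [div_mul_eq_mul_div, div_lt_iff₀ (by positivity)]
    nlinarith

theorem midpointSum_le {N : ℕ} {f : ℝ → ℝ} {C : ℝ} (hC : 0 ≤ C)
    (hf : ∀ x ∈ Set.Ioo 0 Real.pi, f x ≤ C) :
    Real.pi / N * ∑ i : Fin N, f ((2 * ((i : ℝ) + 1) - 1) / (2 * N) * Real.pi)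
      ≤ Real.pi * C := by
  rcases Nat.eq_zero_or_pos N with rfl | hN
  · simp; positivity
  have hN' : (0 : ℝ) < N := by exact_mod_cast hN
  have h := Finset.sum_le_sum (s := (Finset.univ : Finset (Fin N)))
    (fun i _ => hf _ (nodeAngle_mem i))
  calc _ ≤ Real.pi / N * ∑ _i : Fin N, C := by gcongr
    _ = _ := by simp; field_simp

theorem laplaceSum_nonneg {K β s : ℝ} (hK : 0 < K) (N : ℕ) : 0 ≤ laplaceSum K β N s :=
  mul_nonneg (by positivity)
    (Finset.sum_nonneg fun i _ => laplaceKernel_nonneg hK (nodeAngle_mem i))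

theorem laplaceSum_le {K β s : ℝ} (hK : 0 < K) (hβ : 0 < β) (hs : 0 ≤ s) (N : ℕ) :
    laplaceSum K β N s ≤ Real.pi * (Real.exp K / K) :=
  midpointSum_le (by positivity) fun _ hx => laplaceKernel_le hK hβ hs hx

theorem laplaceSum_mul_sqrt_le {K β s : ℝ} (hK : 0 < K) (hβ : 0 < β) (hs : 0 < s) (N : ℕ) :
    laplaceSum K β N s * √s ≤ Real.pi * (Real.exp K / K * (2 / √β)) := by
  rw [laplaceSum, mul_assoc, Finset.sum_mul]
  exact midpointSum_le (f := fun x => laplaceKernel K β s x * √s) (by positivity)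
    fun _ hx => laplaceKernel_mul_sqrt_le hK hβ hs hx

/-- Convergence is joint in `N` and `s` because `s` varies with the node of the outer sum. -/
theorem tendsto_laplaceSum {K β s : ℝ} (hK : 0 < K) (hβ : 0 < β) (hs : 0 < s) :
    Tendsto (fun p : ℕ × ℝ => laplaceSum K β p.1 p.2) (atTop ×ˢ 𝓝 s) (𝓝 (laplaceSinr K β s)) := by
  unfold laplaceSum laplaceSinr
  refine tendsto_sum_midpoint (ι := ℕ × ℝ) (n := Prod.fst) (f := fun p => laplaceKernel K β p.2)
    (f₀ := laplaceKernel K β s)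
    (C := Real.exp K / K) tendsto_fst ?_ ?_
  · have : ∀ᶠ p : ℕ × ℝ in atTop ×ˢ 𝓝 s, 0 < p.2 :=
      tendsto_snd.eventually (eventually_gt_nhds hs)
    filter_upwards [this] with p hp x hx
    rw [abs_of_nonneg (laplaceKernel_nonneg hK hx)]
    exact laplaceKernel_le hK hβ hp.le hx
  · intro x hx
    have h : Tendsto (fun q : (ℕ × ℝ) × ℝ => (q.1.2, q.2)) ((atTop ×ˢ 𝓝 s) ×ˢ 𝓝 x)
        (𝓝 (s, x)) :=
      (tendsto_snd.comp tendsto_fst).prodMk_nhds tendsto_snd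
    have h2 : Tendsto (fun p : ℝ × ℝ => laplaceKernel K β p.1 p.2) (𝓝 (s, x))
        (𝓝 (laplaceKernel K β s x)) := continuousAt_laplaceKernel K β s hx
    simpa only [Function.comp_def] using h2.comp h

theorem sin_div_mul_pow_le {φ κ p A B : ℝ} {T : ℕ} (hφ : φ ∈ Set.Ioo 0 Real.pi) (hκ : 0 < κ)
    (hp : 0 ≤ p) (hA : p ≤ A) (hB : p * √(κ / (1 + Real.cos φ)) ≤ B) (hT : 1 ≤ T) :
    Real.sin φ / (1 + Real.cos φ) * p ^ T ≤ √(2 / κ) * B * A ^ (T - 1) := by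
  have h0 := Real.sin_pos_of_mem_Ioo hφ
  have hc : 0 < 1 + Real.cos φ := by linarith [(cos_mem_Ioo hφ).1]
  have hc1 := (cos_mem_Ioo hφ).2
  have hA0 : 0 ≤ A := hp.trans hA
  have hsin : Real.sin φ / (1 + Real.cos φ) ≤ √(2 / κ) * √(κ / (1 + Real.cos φ)) := by
    rw [← Real.sqrt_mul (by positivity)]
    refine Real.le_sqrt_of_sq_le ?_
    rw [div_pow, Real.sin_sq]
    rw [show 2 / κ * (κ / (1 + Real.cos φ)) = 2 / (1 + Real.cos φ) by field_simp,
      div_le_div_iff₀ (by positivity) hc]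
    nlinarith
  obtain ⟨t, rfl⟩ : ∃ t, T = t + 1 := ⟨T - 1, by omega⟩
  rw [Nat.add_sub_cancel, pow_succ]
  calc Real.sin φ / (1 + Real.cos φ) * (p ^ t * p)
      ≤ √(2 / κ) * √(κ / (1 + Real.cos φ)) * (A ^ t * p) := by gcongr
    _ = √(2 / κ) * (p * √(κ / (1 + Real.cos φ))) * A ^ t := by ring
    _ ≤ _ := by gcongr

/-- One of the `T ≥ 1` factors supplies `√(1 + cos φ)`, which tames the weight at `φ = π`; the other
factors are merely bounded. -/
theorem tendsto_sum_sin_mul_laplaceSum {K β κ : ℝ} {T : ℕ} (hK : 0 < K) (hβ : 0 < β) (hκ : 0 < κ)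
    (hT : 1 ≤ T) :
    Tendsto (fun N : ℕ => Real.pi / N * ∑ i : Fin N,
      (fun φ => Real.sin φ / (1 + Real.cos φ) * laplaceSum K β N (κ / (1 + Real.cos φ)) ^ T)
        ((2 * ((i : ℝ) + 1) - 1) / (2 * N) * Real.pi)) atTop
      (𝓝 (∫ φ in (0 : ℝ)..Real.pi,
        Real.sin φ / (1 + Real.cos φ) * laplaceSinr K β (κ / (1 + Real.cos φ)) ^ T)) := by
  refine tendsto_sum_midpoint (ι := ℕ) (n := id)
    (f := fun N φ => Real.sin φ / (1 + Real.cos φ) * laplaceSum K β N (κ / (1 + Real.cos φ)) ^ T)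
    (C := √(2 / κ) * (Real.pi * (Real.exp K / K * (2 / √β))) *
      (Real.pi * (Real.exp K / K)) ^ (T - 1)) tendsto_id ?_ ?_
  · refine Eventually.of_forall fun N φ hφ => ?_
    have h0 := Real.sin_pos_of_mem_Ioo hφ
    have hc : 0 < 1 + Real.cos φ := by linarith [(cos_mem_Ioo hφ).1]
    have hs : 0 < κ / (1 + Real.cos φ) := by positivity
    have hp := laplaceSum_nonneg (β := β) (s := κ / (1 + Real.cos φ)) hK N
    rw [abs_of_nonneg (by positivity)]
    exact sin_div_mul_pow_le hφ hκ hp (laplaceSum_le hK hβ hs.le N)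
      (laplaceSum_mul_sqrt_le hK hβ hs N) hT
  · intro φ hφ
    have hc : 0 < 1 + Real.cos φ := by linarith [(cos_mem_Ioo hφ).1]
    have hs : 0 < κ / (1 + Real.cos φ) := by positivity
    have h1 : ContinuousAt (fun x => Real.sin x / (1 + Real.cos x)) φ :=
      ContinuousAt.div (by fun_prop) (by fun_prop) hc.ne'
    have h2 : ContinuousAt (fun x => κ / (1 + Real.cos x)) φ :=
      ContinuousAt.div (by fun_prop) (by fun_prop) hc.ne'
    refine (h1.tendsto.comp tendsto_snd).mul (Tendsto.pow ?_ T)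
    exact (tendsto_laplaceSum hK hβ hs).comp
      (tendsto_fst.prodMk (h2.tendsto.comp tendsto_snd))

/-! ### The closed form as a double quadrature -/

theorem cConst_mul_cFun {α₁ α₂ ρ lam : ℝ} (hα₁ : 0 < α₁) (hα₂ : 0 < α₂) (hρ : 0 < ρ)
    (hlam : 0 < lam) (N : ℕ) {φ : ℝ} (hφ : φ ∈ Set.Ioo 0 Real.pi) :
    cConst α₁ α₂ ρ lam N * cFun α₁ α₂ ρ lam (Real.cos φ) =
      Real.pi / N * laplaceKernel (1 / (α₂ * lam * ρ)) (α₁ / α₂) 0 φ := by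
  have h0 := Real.sin_pos_of_mem_Ioo hφ
  have hc : 0 < 1 - Real.cos φ := by linarith [(cos_mem_Ioo hφ).2]
  have hs : √(1 - Real.cos φ ^ 2) = Real.sin φ := by
    rw [← Real.sin_sq, Real.sqrt_sq h0.le]
  have e1 : 2 * α₁ - α₂ * (α₁ / α₂) * (Real.cos φ + 1) = α₁ * (1 - Real.cos φ) := by
    field_simp; ring
  rw [cConst, cFun, laplaceKernel, hs, e1, zero_mul, neg_zero, Real.exp_zero, mul_one]
  have e2 : Real.exp (-(1 / (α₂ * lam * ρ) * (1 + Real.cos φ) / (1 - Real.cos φ)))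
      = Real.exp (1 / (α₂ * lam * ρ)) *
        Real.exp (-(2 * α₁ / (α₂ * lam * ρ * (α₁ * (1 - Real.cos φ))))) := by
    rw [← Real.exp_add]; congr 1; field_simp; ring
  rw [e2]
  -- For `N = 0` both sides vanish, since division by zero gives zero.
  rcases Nat.eq_zero_or_pos N with rfl | hN
  · simp
  have hN' : (0 : ℝ) < N := by exact_mod_cast hN
  field_simp

theorem sum_indexSet_eq_pow {N T : ℕ} (c : ℝ) (a θ : Fin N → ℝ) :
    c ^ T * ∑ j ∈ indexSet N T, ((T.factorial : ℝ) / ∏ n, ((j n).factorial : ℝ)) *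
      (∏ n, a n ^ j n) * Real.exp (-∑ n, (j n : ℝ) * θ n)
      = (∑ n, c * a n * Real.exp (-θ n)) ^ T := by
  rw [Finset.sum_pow_eq_sum_piAntidiag, indexSet, Finset.mul_sum]
  refine Finset.sum_congr rfl fun j hj => ?_
  have hsum : ∑ n, j n = T := (Finset.mem_piAntidiag.1 hj).1
  have hspec := Nat.multinomial_spec Finset.univ j
  rw [hsum] at hspec
  have hspec' : (∏ n, ((j n).factorial : ℝ)) * (Nat.multinomial Finset.univ j : ℝ)
      = (T.factorial : ℝ) := by exact_mod_cast hspec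
  have hne : (∏ n, ((j n).factorial : ℝ)) ≠ 0 :=
    Finset.prod_ne_zero_iff.2 fun n _ => by exact_mod_cast (j n).factorial_ne_zero
  have e : (T.factorial : ℝ) / ∏ n, ((j n).factorial : ℝ) = (Nat.multinomial Finset.univ j : ℝ) := by
    rw [← hspec', mul_div_cancel_left₀ _ hne]
  have e2 : Real.exp (-∑ n, (j n : ℝ) * θ n) = ∏ n, Real.exp (-θ n) ^ j n := by
    rw [← Finset.sum_neg_distrib, Real.exp_sum]
    refine Finset.prod_congr rfl fun n _ => ?_
    rw [← Real.exp_nat_mul]; congr 1; ring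
  rw [e, e2]
  simp_rw [mul_pow]
  rw [Finset.prod_mul_distrib, Finset.prod_mul_distrib, Finset.prod_pow_eq_pow_sum, hsum]
  ring

/-- The exponent is linear in `j`, so for fixed `k` and `m` the sum over the index set is a
multinomial expansion. -/
theorem closedForm_eq {α₁ α₂ ρ lam r : ℝ} (hα₁ : 0 < α₁) (hα₂ : 0 < α₂) (hρ : 0 < ρ)
    (hlam : 0 < lam) (hr : 0 < r) (T N L : ℕ) :
    closedForm α₁ α₂ ρ lam r T N L = ∑ k ∈ Finset.Icc 1 L, Real.log 2 * weight L k *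
      (Real.pi / N * ∑ i : Fin N, (fun φ => Real.sin φ / (1 + Real.cos φ) *
        laplaceSum (1 / (α₂ * lam * ρ)) (α₁ / α₂) N
          (2 * k * Real.log 2 / r / (1 + Real.cos φ)) ^ T)
        ((2 * ((i : ℝ) + 1) - 1) / (2 * N) * Real.pi)) := by
  set ang : Fin N → ℝ := fun i => (2 * ((i : ℝ) + 1) - 1) / (2 * N) * Real.pi with hang
  have hmem : ∀ i, ang i ∈ Set.Ioo 0 Real.pi := fun i => nodeAngle_mem i
  have hnode : ∀ i, node N i = Real.cos (ang i) := fun i => rfl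
  have hpow : ∀ s : ℝ, laplaceSum (1 / (α₂ * lam * ρ)) (α₁ / α₂) N s ^ T
      = cConst α₁ α₂ ρ lam N ^ T * ∑ j ∈ indexSet N T,
        ((T.factorial : ℝ) / ∏ n, ((j n).factorial : ℝ)) *
        (∏ n, cFun α₁ α₂ ρ lam (node N n) ^ j n) *
        Real.exp (-∑ n, (j n : ℝ) * (s * (α₁ / α₂ * (1 + node N n) / 2))) := by
    intro s
    rw [sum_indexSet_eq_pow, laplaceSum, Finset.mul_sum]
    congr 1
    refine Finset.sum_congr rfl fun n _ => ?_
    rw [hnode, cConst_mul_cFun hα₁ hα₂ hρ hlam N (hmem n)]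
    simp only [laplaceKernel, zero_mul, neg_zero, Real.exp_zero, mul_one, hang]
    ring
  rw [closedForm]
  simp_rw [hpow, Finset.mul_sum]
  rw [Finset.sum_comm]
  refine Eq.trans (Finset.sum_congr rfl fun m _ => Finset.sum_comm) ?_
  rw [Finset.sum_comm]
  refine Finset.sum_congr rfl fun k _ => Finset.sum_congr rfl fun m _ =>
    Finset.sum_congr rfl fun j _ => ?_
  have h0 := Real.sin_pos_of_mem_Ioo (hmem m)
  have hs : √(1 - Real.cos (ang m) ^ 2) = Real.sin (ang m) := by
    rw [← Real.sin_sq, Real.sqrt_sq h0.le]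
  have hc : 0 < 1 + Real.cos (ang m) := by linarith [(cos_mem_Ioo (hmem m)).1]
  have hexp : (∑ n, (j n : ℝ) * (α₁ / α₂) * (node N n + 1)) * k * Real.log 2 /
        (r * (1 + node N m)) = ∑ n, (j n : ℝ) * (2 * k * Real.log 2 / r / (1 + Real.cos (ang m)) *
          (α₁ / α₂ * (1 + node N n) / 2)) := by
    rw [Finset.sum_mul, Finset.sum_mul, Finset.sum_div]
    refine Finset.sum_congr rfl fun n _ => ?_
    rw [hnode m]
    field_simp
    ring
  have hm : (2 * (((m : ℕ) : ℝ) + 1) - 1) / (2 * N) * Real.pi = ang m := rfl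
  rw [hexp, hnode m, hs]
  simp only [hm]
  generalize Real.exp (-∑ n, (j n : ℝ) * (2 * k * Real.log 2 / r / (1 + Real.cos (ang m)) *
          (α₁ / α₂ * (1 + node N n) / 2))) = E
  have hN' : (0 : ℝ) < N := by exact_mod_cast m.pos
  field_simp

theorem tendsto_closedForm {α₁ α₂ ρ lam r : ℝ} (hα₁ : 0 < α₁) (hα₂ : 0 < α₂) (hρ : 0 < ρ)
    (hlam : 0 < lam) (hr : 0 < r) {T : ℕ} (hT : 1 ≤ T) (L : ℕ) :
    Tendsto (fun N => closedForm α₁ α₂ ρ lam r T N L) atTop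
      (𝓝 (∑ k ∈ Finset.Icc 1 L, Real.log 2 * weight L k *
        ∫ φ in (0 : ℝ)..Real.pi, Real.sin φ / (1 + Real.cos φ) *
          laplaceSinr (1 / (α₂ * lam * ρ)) (α₁ / α₂)
            (2 * k * Real.log 2 / r / (1 + Real.cos φ)) ^ T)) := by
  simp_rw [closedForm_eq hα₁ hα₂ hρ hlam hr T _ L]
  refine tendsto_finsetSum _ fun k hk => Tendsto.const_mul _ ?_
  have hk1 : (1 : ℝ) ≤ k := by exact_mod_cast (Finset.mem_Icc.1 hk).1
  have hl : 0 < Real.log 2 := Real.log_pos one_lt_two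
  exact tendsto_sum_sin_mul_laplaceSum (by positivity) (by positivity) (by positivity) hT

/-! ### Law of a single-round SINR -/

/-- The standard exponential law. -/
noncomputable def expLaw : Measure ℝ :=
  (volume.restrict (Set.Ioi 0)).withDensity fun x => ENNReal.ofReal (Real.exp (-x))

theorem lintegral_expLaw {h : ℝ → ENNReal} (hh : Measurable h) :
    ∫⁻ x, h x ∂expLaw = ∫⁻ x in Set.Ioi (0 : ℝ), ENNReal.ofReal (Real.exp (-x)) * h x := by
  rw [expLaw, lintegral_withDensity_eq_lintegral_mul _ (by fun_prop) hh]
  rfl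

instance : IsProbabilityMeasure expLaw := by
  refine ⟨?_⟩
  have h := lintegral_expLaw (h := fun _ => 1) measurable_const
  simp only [lintegral_one, mul_one] at h
  rw [h, ← ofReal_integral_eq_lintegral_ofReal (integrableOn_exp_neg_Ioi 0)
    (Eventually.of_forall fun x => (Real.exp_pos _).le), integral_exp_neg_Ioi]
  simp

theorem gaussianPDF_zero_half_mul (x y : ℝ) :
    gaussianPDF 0 (1 / 2) x * gaussianPDF 0 (1 / 2) y
      = ENNReal.ofReal (Real.pi⁻¹ * Real.exp (-(x ^ 2 + y ^ 2))) := by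
  rw [gaussianPDF, gaussianPDF, ← ENNReal.ofReal_mul (gaussianPDFReal_nonneg _ _ _),
    gaussianPDFReal, gaussianPDFReal]
  congr 1
  have e : (2 : ℝ) * Real.pi * ((1 / 2 : NNReal) : ℝ) = Real.pi := by push_cast; ring
  have e2 : (2 : ℝ) * ((1 / 2 : NNReal) : ℝ) = 1 := by push_cast; ring
  rw [e, e2, neg_add, Real.exp_add]
  have h : (√Real.pi)⁻¹ * (√Real.pi)⁻¹ = Real.pi⁻¹ := by
    rw [← mul_inv, Real.mul_self_sqrt Real.pi_pos.le]
  rw [← h]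
  simp only [sub_zero, div_one]
  ring

theorem lintegral_Ioi_comp_sq (F : ℝ → ENNReal) :
    ∫⁻ r in Set.Ioi (0 : ℝ), ENNReal.ofReal (2 * r) * F (r ^ 2) = ∫⁻ x in Set.Ioi (0 : ℝ), F x := by
  have himg : (fun r : ℝ => r ^ 2) '' Set.Ioi 0 = Set.Ioi 0 := by
    ext u
    simp only [Set.mem_image, Set.mem_Ioi]
    constructor
    · rintro ⟨r, hr, rfl⟩; positivity
    · intro hu; exact ⟨√u, Real.sqrt_pos.2 hu, Real.sq_sqrt hu.le⟩
  conv_rhs => rw [← himg]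
  rw [lintegral_image_eq_lintegral_abs_deriv_mul (f' := fun r => 2 * r) measurableSet_Ioi]
  · refine setLIntegral_congr_fun measurableSet_Ioi fun r hr => ?_
    have : (0 : ℝ) < 2 * r := mul_pos two_pos hr
    simp only [abs_of_pos this]
  · intro r _
    simpa using (hasDerivAt_pow 2 r).hasDerivWithinAt
  · intro a ha b hb hab
    exact (pow_left_inj₀ (le_of_lt ha) (le_of_lt hb) two_ne_zero).1 hab

/-- In polar coordinates the density `π⁻¹ e ^ (-r²)` has angular mass `2π`, and `2 r dr = d(r²)`. -/
theorem map_norm_sq_complexGaussian :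
    complexGaussian.map (fun z : ℂ => ‖z‖ ^ 2) = expLaw := by
  refine Measure.ext_of_lintegral _ fun h hh => ?_
  have hmk : Measurable fun p : ℝ × ℝ => (⟨p.1, p.2⟩ : ℂ) :=
    Complex.measurableEquivRealProd.symm.measurable
  rw [lintegral_map hh (by fun_prop), complexGaussian, lintegral_map (by fun_prop) hmk,
    gaussianReal_of_var_ne_zero 0 (by norm_num),
    prod_withDensity (measurable_gaussianPDF _ _) (measurable_gaussianPDF _ _),
    lintegral_withDensity_eq_lintegral_mul _ (by fun_prop)
      (by fun_prop), ← Measure.volume_eq_prod, ← lintegral_comp_polarCoord_symm, polarCoord_target,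
    Measure.volume_eq_prod, ← Measure.prod_restrict, lintegral_expLaw hh, ← lintegral_Ioi_comp_sq]
  have e : ∀ p : ℝ × ℝ, ENNReal.ofReal p.1 • ((fun z : ℝ × ℝ => gaussianPDF 0 (1 / 2) z.1 *
      gaussianPDF 0 (1 / 2) z.2) * fun p : ℝ × ℝ => h (‖(⟨p.1, p.2⟩ : ℂ)‖ ^ 2)) (polarCoord.symm p)
      = (ENNReal.ofReal p.1 * (ENNReal.ofReal (Real.pi⁻¹ * Real.exp (-p.1 ^ 2)) * h (p.1 ^ 2)))
        * 1 := by
    rintro ⟨r, θ⟩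
    have hs : (r * Real.cos θ) ^ 2 + (r * Real.sin θ) ^ 2 = r ^ 2 := by
      have := Real.sin_sq_add_cos_sq θ
      linear_combination r ^ 2 * this
    simp only [polarCoord_symm_apply, Pi.mul_apply, smul_eq_mul, gaussianPDF_zero_half_mul, hs,
      Complex.sq_norm, Complex.normSq_mk, mul_one]
    rw [← pow_two, ← pow_two, hs]
  simp_rw [e]
  refine (lintegral_prod_mul (f := fun r : ℝ => ENNReal.ofReal r *
    (ENNReal.ofReal (Real.pi⁻¹ * Real.exp (-r ^ 2)) * h (r ^ 2))) (g := fun _ : ℝ => 1)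
    (by fun_prop) (by fun_prop)).trans ?_
  simp only [lintegral_one, Measure.restrict_apply_univ, Real.volume_Ioo]
  rw [← lintegral_mul_const _ (by fun_prop)]
  refine setLIntegral_congr_fun measurableSet_Ioi fun r hr => ?_
  have hr0 : (0 : ℝ) < r := hr
  have hpi := Real.pi_pos
  rw [← mul_assoc, mul_right_comm, ← ENNReal.ofReal_mul hr0.le,
    ← ENNReal.ofReal_mul (by positivity),
    ← mul_assoc (ENNReal.ofReal (2 * r)), ← ENNReal.ofReal_mul (by positivity)]
  congr 2
  field_simp
  ring

/-- The law of `β X / (X + K)` for a standard exponential `X`. -/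
noncomputable def sinrLaw (K β : ℝ) : Measure ℝ := expLaw.map fun x => β * x / (x + K)

theorem measurable_sinrMap (K β : ℝ) : Measurable fun x : ℝ => β * x / (x + K) := by fun_prop

instance (K β : ℝ) : IsProbabilityMeasure (sinrLaw K β) :=
  Measure.isProbabilityMeasure_map (measurable_sinrMap K β).aemeasurable

theorem image_angle_eq {K : ℝ} (hK : 0 < K) :
    (fun φ : ℝ => K * (1 + Real.cos φ) / (1 - Real.cos φ)) '' Set.Ioo 0 Real.pi = Set.Ioi 0 := by
  ext u
  simp only [Set.mem_image, Set.mem_Ioi]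
  constructor
  · rintro ⟨φ, hφ, rfl⟩
    have := cos_mem_Ioo hφ
    exact div_pos (mul_pos hK (by linarith [this.1])) (by linarith [this.2])
  · intro hu
    have h1 : -1 < (u - K) / (u + K) := by rw [lt_div_iff₀ (by linarith)]; linarith
    have h2 : (u - K) / (u + K) < 1 := by rw [div_lt_iff₀ (by linarith)]; linarith
    refine ⟨Real.arccos ((u - K) / (u + K)), ⟨Real.arccos_pos.2 h2, ?_⟩, ?_⟩
    · refine lt_of_le_of_ne (Real.arccos_le_pi _) fun h => ?_
      rw [Real.arccos_eq_pi] at h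
      linarith
    · rw [Real.cos_arccos h1.le h2.le]
      have : u + K ≠ 0 := by positivity
      have h3 : 1 - (u - K) / (u + K) = 2 * K / (u + K) := by field_simp; ring
      rw [h3]
      field_simp
      ring

theorem injOn_angle {K : ℝ} (hK : 0 < K) :
    Set.InjOn (fun φ : ℝ => K * (1 + Real.cos φ) / (1 - Real.cos φ)) (Set.Ioo 0 Real.pi) := by
  intro a ha b hb hab
  have h1 : 1 - Real.cos a ≠ 0 := by linarith [(cos_mem_Ioo ha).2]
  have h2 : 1 - Real.cos b ≠ 0 := by linarith [(cos_mem_Ioo hb).2]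
  refine Real.injOn_cos (Set.Ioo_subset_Icc_self ha) (Set.Ioo_subset_Icc_self hb) ?_
  simp only at hab
  field_simp at hab
  linarith

/-- Under `x = K (1 + cos φ) / (1 - cos φ)` the SINR `β x / (x + K)` becomes `β (1 + cos φ) / 2`,
affine in the Chebyshev variable. -/
theorem lintegral_sinrLaw {K β : ℝ} (hK : 0 < K) {h : ℝ → ENNReal} (hh : Measurable h) :
    ∫⁻ x, h x ∂sinrLaw K β = ∫⁻ φ in Set.Ioo 0 Real.pi,
      ENNReal.ofReal (laplaceKernel K β 0 φ) * h (β * (1 + Real.cos φ) / 2) := by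
  rw [sinrLaw, lintegral_map hh (measurable_sinrMap K β),
    lintegral_expLaw (h := fun x => h (β * x / (x + K))) (hh.comp (measurable_sinrMap K β)), ← image_angle_eq hK,
    lintegral_image_eq_lintegral_abs_deriv_mul
      (f' := fun φ => -(2 * K * Real.sin φ / (1 - Real.cos φ) ^ 2)) measurableSet_Ioo _
      (injOn_angle hK)]
  · refine setLIntegral_congr_fun measurableSet_Ioo fun φ hφ => ?_
    have h0 := Real.sin_pos_of_mem_Ioo hφ
    have hc : 0 < 1 - Real.cos φ := by linarith [(cos_mem_Ioo hφ).2]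
    have hx : β * (K * (1 + Real.cos φ) / (1 - Real.cos φ)) /
        (K * (1 + Real.cos φ) / (1 - Real.cos φ) + K) = β * (1 + Real.cos φ) / 2 := by
      have : K * (1 + Real.cos φ) / (1 - Real.cos φ) + K = 2 * K / (1 - Real.cos φ) := by
        field_simp; ring
      rw [this]; field_simp
    simp only [hx]
    rw [abs_neg, abs_of_nonneg (by positivity), ← mul_assoc, ← ENNReal.ofReal_mul (by positivity),
      laplaceKernel]
    simp
  · intro φ hφ
    have hc : 1 - Real.cos φ ≠ 0 := by linarith [(cos_mem_Ioo hφ).2]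
    have h1 : HasDerivAt (fun φ => K * (1 + Real.cos φ)) (K * -Real.sin φ) φ :=
      ((Real.hasDerivAt_cos φ).const_add 1).const_mul K
    have h2 : HasDerivAt (fun φ => 1 - Real.cos φ) (- -Real.sin φ) φ :=
      (Real.hasDerivAt_cos φ).const_sub 1
    refine ((h1.div h2 hc).congr_deriv ?_).hasDerivWithinAt
    field_simp
    ring

/-- The kernel is at most a constant times `sin φ`, and `sin φ` is up to a constant the Jacobian of
`φ ↦ β (1 + cos φ) / 2`; hence the density is bounded. -/
theorem sinrLaw_le {K β : ℝ} (hK : 0 < K) (hβ : 0 < β) {A : Set ℝ} (hA : MeasurableSet A) :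
    sinrLaw K β A ≤ ENNReal.ofReal (Real.exp K / K * (2 / β)) * volume A := by
  have h := lintegral_sinrLaw (β := β) hK (h := A.indicator 1) (measurable_one.indicator hA)
  rw [lintegral_indicator_one hA] at h
  have himg := lintegral_image_eq_lintegral_abs_deriv_mul
    (f := fun φ => β * (1 + Real.cos φ) / 2) (f' := fun φ => β * -Real.sin φ / 2)
    (s := Set.Ioo 0 Real.pi) measurableSet_Ioo
    (fun φ _ => ((((Real.hasDerivAt_cos φ).const_add 1).const_mul β).div_const 2).hasDerivWithinAt)
    (by
      intro a ha b hb hab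
      refine Real.injOn_cos (Set.Ioo_subset_Icc_self ha) (Set.Ioo_subset_Icc_self hb) ?_
      simp only at hab
      have := hβ.ne'
      field_simp at hab
      linarith) (A.indicator 1)
  calc sinrLaw K β A = _ := h
    _ ≤ ∫⁻ φ in Set.Ioo 0 Real.pi, ENNReal.ofReal (Real.exp K / K * (2 / β)) *
        (ENNReal.ofReal |β * -Real.sin φ / 2| * A.indicator 1 (β * (1 + Real.cos φ) / 2)) := by
        refine setLIntegral_mono' measurableSet_Ioo fun φ hφ => ?_
        rw [← mul_assoc, ← ENNReal.ofReal_mul (by positivity)]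
        gcongr
        have h0 := Real.sin_pos_of_mem_Ioo hφ
        refine (laplaceKernel_le_sin hK hφ).trans (le_of_eq ?_)
        rw [show β * -Real.sin φ / 2 = -(β * Real.sin φ / 2) by ring, abs_neg,
          abs_of_pos (by positivity)]
        simp
        field_simp
    _ = ENNReal.ofReal (Real.exp K / K * (2 / β)) * ∫⁻ x in
          (fun φ => β * (1 + Real.cos φ) / 2) '' Set.Ioo 0 Real.pi, A.indicator 1 x := by
        rw [himg, lintegral_const_mul' _ _ ENNReal.ofReal_ne_top]
    _ ≤ _ := by
        gcongr
        refine (setLIntegral_le_lintegral _ _).trans ?_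
        rw [lintegral_indicator_one hA]

theorem sinrLaw_Iic_zero {K β : ℝ} (hK : 0 < K) (hβ : 0 < β) : sinrLaw K β (Set.Iic 0) = 0 := by
  have h := lintegral_sinrLaw (β := β) hK (h := (Set.Iic 0).indicator 1)
    (measurable_one.indicator measurableSet_Iic)
  rw [lintegral_indicator_one measurableSet_Iic] at h
  rw [h]
  refine (setLIntegral_congr_fun measurableSet_Ioo (g := fun _ => 0) fun φ hφ => ?_).trans
    (by simp)
  have hc : 0 < 1 + Real.cos φ := by linarith [(cos_mem_Ioo hφ).1]
  have : β * (1 + Real.cos φ) / 2 ∉ Set.Iic (0 : ℝ) := by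
    rw [Set.mem_Iic, not_le]; positivity
  simp only [Set.indicator_of_notMem this, mul_zero]

theorem lintegral_exp_neg_sinrLaw {K β s : ℝ} (hK : 0 < K) (hβ : 0 < β) (hs : 0 ≤ s) :
    ∫⁻ x, ENNReal.ofReal (Real.exp (-(s * x))) ∂sinrLaw K β
      = ENNReal.ofReal (laplaceSinr K β s) := by
  rw [lintegral_sinrLaw hK (by fun_prop), laplaceSinr,
    intervalIntegral.integral_of_le Real.pi_pos.le, integral_Ioc_eq_integral_Ioo,
    ofReal_integral_eq_lintegral_ofReal]
  · refine setLIntegral_congr_fun measurableSet_Ioo fun φ hφ => ?_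
    rw [← ENNReal.ofReal_mul (laplaceKernel_nonneg hK hφ)]
    congr 1
    simp [laplaceKernel]
  · refine Integrable.mono' (g := fun _ => Real.exp K / K) (integrableOn_const (by simp))
      ?_ ?_
    · unfold laplaceKernel
      exact Measurable.aestronglyMeasurable (by fun_prop)
    · rw [ae_restrict_iff' measurableSet_Ioo]
      refine Eventually.of_forall fun φ hφ => ?_
      rw [Real.norm_of_nonneg (laplaceKernel_nonneg hK hφ)]
      exact laplaceKernel_le hK hβ hs hφ
  · rw [EventuallyLE, ae_restrict_iff' measurableSet_Ioo]
    exact Eventually.of_forall fun φ hφ => laplaceKernel_nonneg hK hφ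

theorem expLaw_real_Iic {a : ℝ} (ha : 0 ≤ a) : expLaw.real (Set.Iic a) = 1 - Real.exp (-a) := by
  have h : expLaw (Set.Ioi a) = ENNReal.ofReal (Real.exp (-a)) := by
    rw [← lintegral_indicator_one measurableSet_Ioi,
      lintegral_expLaw (measurable_one.indicator measurableSet_Ioi)]
    have e : ∀ x : ℝ, ENNReal.ofReal (Real.exp (-x)) * (Set.Ioi a).indicator 1 x
        = (Set.Ioi a).indicator (fun x => ENNReal.ofReal (Real.exp (-x))) x := by
      intro x
      by_cases hx : x ∈ Set.Ioi a <;> simp [hx]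
    simp_rw [e]
    rw [setLIntegral_indicator measurableSet_Ioi, Set.inter_eq_left.2 (Set.Ioi_subset_Ioi ha),
      ← ofReal_integral_eq_lintegral_ofReal (integrableOn_exp_neg_Ioi a)
      (Eventually.of_forall fun x => (Real.exp_pos _).le), integral_exp_neg_Ioi]
  have h2 : expLaw.real (Set.Ioi a) = Real.exp (-a) := by
    rw [measureReal_def, h, ENNReal.toReal_ofReal (Real.exp_pos _).le]
  rw [← Set.compl_Ioi, probReal_compl_eq_one_sub measurableSet_Ioi, h2]

theorem expLaw_Iic_zero : expLaw (Set.Iic 0) = 0 := by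
  have h := expLaw_real_Iic le_rfl
  simp only [neg_zero, Real.exp_zero, sub_self] at h
  rwa [measureReal_eq_zero_iff] at h

theorem sinrLaw_real_Iic {K β t : ℝ} (hK : 0 < K) (ht0 : 0 ≤ t) (ht : t < β) :
    (sinrLaw K β).real (Set.Iic t) = 1 - Real.exp (-(K * t / (β - t))) := by
  have hb : 0 < β - t := by linarith
  rw [← expLaw_real_Iic (by positivity), sinrLaw,
    map_measureReal_apply (measurable_sinrMap K β) measurableSet_Iic]
  have hae : ∀ᵐ x ∂expLaw, 0 < x := by
    rw [ae_iff]
    simpa [Set.Iic_def] using expLaw_Iic_zero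
  refine measureReal_congr ?_
  filter_upwards [hae] with x hx
  apply propext
  change β * x / (x + K) ≤ t ↔ x ≤ K * t / (β - t)
  rw [div_le_iff₀ (by positivity), le_div_iff₀ hb]
  constructor <;> intro h <;> linarith

theorem sinrLaw_real_Iic_of_le {K β t : ℝ} (hK : 0 < K) (hβ : 0 < β) (ht : β ≤ t) :
    (sinrLaw K β).real (Set.Iic t) = 1 := by
  rw [sinrLaw, map_measureReal_apply (measurable_sinrMap K β) measurableSet_Iic]
  have hae : ∀ᵐ x ∂expLaw, 0 < x := by
    rw [ae_iff]
    simpa [Set.Iic_def] using expLaw_Iic_zero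
  rw [← probReal_univ (μ := expLaw)]
  refine measureReal_congr ?_
  filter_upwards [hae] with x hx
  apply propext
  change β * x / (x + K) ≤ t ↔ True
  rw [div_le_iff₀ (by positivity)]
  simp only [iff_true]
  nlinarith [mul_le_mul_of_nonneg_right ht hx.le, mul_nonneg (hβ.le.trans ht) hK.le]

theorem sinrLaw_real_Iic_of_nonpos {K β t : ℝ} (hK : 0 < K) (hβ : 0 < β) (ht : t ≤ 0) :
    (sinrLaw K β).real (Set.Iic t) = 0 := by
  rw [measureReal_eq_zero_iff]
  exact measure_mono_null (Set.Iic_subset_Iic.2 ht) (sinrLaw_Iic_zero hK hβ)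

theorem differentiableAt_sinrLaw_real_Iic {K β t : ℝ} (hK : 0 < K) (hβ : 0 < β) (ht0 : t ≠ 0)
    (htβ : t ≠ β) : DifferentiableAt ℝ (fun t => (sinrLaw K β).real (Set.Iic t)) t := by
  rcases lt_or_gt_of_ne ht0 with h | h
  · refine (differentiableAt_const (0 : ℝ)).congr_of_eventuallyEq ?_
    filter_upwards [eventually_lt_nhds h] with x hx
    exact sinrLaw_real_Iic_of_nonpos hK hβ hx.le
  rcases lt_or_gt_of_ne htβ with h2 | h2
  · have hd : DifferentiableAt ℝ (fun t => 1 - Real.exp (-(K * t / (β - t)))) t := by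
      have : β - t ≠ 0 := by linarith
      fun_prop (disch := assumption)
    refine hd.congr_of_eventuallyEq ?_
    filter_upwards [eventually_lt_nhds h2, eventually_gt_nhds h] with x hx hx0
    exact sinrLaw_real_Iic hK hx0.le hx
  · refine (differentiableAt_const (1 : ℝ)).congr_of_eventuallyEq ?_
    filter_upwards [eventually_gt_nhds h2] with x hx
    exact sinrLaw_real_Iic_of_le hK hβ hx.le

/-! ### Sums of independent SINRs and smoothness of their distribution function -/

/-- The law of the sum of `T` independent variables with common law `ν`. -/
noncomputable def sumLaw (ν : Measure ℝ) : ℕ → Measure ℝ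
  | 0 => Measure.dirac 0
  | t + 1 => ν ∗ sumLaw ν t

instance (ν : Measure ℝ) [IsProbabilityMeasure ν] (T : ℕ) : IsProbabilityMeasure (sumLaw ν T) := by
  induction T with
  | zero => rw [sumLaw]; infer_instance
  | succ t ih => rw [sumLaw]; infer_instance

theorem map_sum_eq_sumLaw {Ω ι : Type*} [MeasurableSpace Ω] {P : Measure Ω}
    [IsProbabilityMeasure P] {ν : Measure ℝ} {X : ι → Ω → ℝ} (hX : ∀ i, AEMeasurable (X i) P)
    (hind : iIndepFun X P) (hν : ∀ i, P.map (X i) = ν) (s : Finset ι) :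
    P.map (∑ i ∈ s, X i) = sumLaw ν s.card := by
  classical
  induction s using Finset.induction_on with
  | empty =>
    rw [Finset.sum_empty, Finset.card_empty, sumLaw]
    change P.map (fun _ => (0 : ℝ)) = _
    simp
  | insert i s hi ih =>
    rw [Finset.sum_insert hi, Finset.card_insert_of_notMem hi, sumLaw,
      IndepFun.map_add_eq_map_conv_map₀ (hX i) (s.aemeasurable_sum fun j _ => hX j)
        (hind.indepFun_finsetSum_of_notMem₀ hX hi).symm, hν, ih]

theorem lintegral_exp_neg_sumLaw (ν : Measure ℝ) [IsProbabilityMeasure ν] (s : ℝ) (T : ℕ) :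
    ∫⁻ x, ENNReal.ofReal (Real.exp (-(s * x))) ∂sumLaw ν T
      = (∫⁻ x, ENNReal.ofReal (Real.exp (-(s * x))) ∂ν) ^ T := by
  induction T with
  | zero => rw [sumLaw, lintegral_dirac' _ (by fun_prop)]; simp
  | succ t ih =>
    rw [sumLaw, Measure.lintegral_conv (by fun_prop), pow_succ', ← ih]
    rw [← lintegral_mul_const _ (by fun_prop)]
    refine lintegral_congr fun x => ?_
    rw [← lintegral_const_mul _ (by fun_prop)]
    refine lintegral_congr fun y => ?_
    rw [← ENNReal.ofReal_mul (Real.exp_pos _).le, ← Real.exp_add]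
    congr 2; ring

theorem conv_apply_eq (ν η : Measure ℝ) [IsProbabilityMeasure ν] [IsProbabilityMeasure η]
    {A : Set ℝ} (hA : MeasurableSet A) : (ν ∗ η) A = ∫⁻ y, ν ((fun x => x + y) ⁻¹' A) ∂η := by
  rw [Measure.conv_comm, ← lintegral_indicator_one hA,
    Measure.lintegral_conv (measurable_one.indicator hA)]
  refine lintegral_congr fun y => ?_
  rw [← lintegral_indicator_one ((measurable_add_const y) hA)]
  refine lintegral_congr fun x => ?_
  rw [add_comm]; rfl

theorem conv_le_mul_volume {ν η : Measure ℝ} [IsProbabilityMeasure ν] [IsProbabilityMeasure η]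
    {c : ENNReal} (hν : ∀ A, MeasurableSet A → ν A ≤ c * volume A) {A : Set ℝ}
    (hA : MeasurableSet A) : (ν ∗ η) A ≤ c * volume A := by
  rw [conv_apply_eq ν η hA]
  calc _ ≤ ∫⁻ _ : ℝ, c * volume A ∂η := by
        refine lintegral_mono fun y => (hν _ (measurable_add_const y hA)).trans ?_
        rw [measure_preimage_add_right]
    _ = _ := by simp

theorem sumLaw_Iio_zero {ν : Measure ℝ} [IsProbabilityMeasure ν] (hν : ν (Set.Iic 0) = 0) (T : ℕ) :
    sumLaw ν T (Set.Iio 0) = 0 := by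
  induction T with
  | zero => rw [sumLaw, Measure.dirac_apply' _ measurableSet_Iio]; simp
  | succ t ih =>
    rw [sumLaw, conv_apply_eq _ _ measurableSet_Iio]
    rw [lintegral_eq_zero_iff' (Measurable.aemeasurable ?_)]
    · have : ∀ᵐ y ∂sumLaw ν t, 0 ≤ y := by
        rw [ae_iff]; simpa [Set.Iio_def] using ih
      filter_upwards [this] with y hy
      refine measure_mono_null (fun x hx => ?_) hν
      simp only [Set.mem_preimage, Set.mem_Iio] at hx
      exact (show x ≤ 0 by linarith)
    · have e : ∀ y : ℝ, ν ((fun x => x + y) ⁻¹' Set.Iio 0) = ν (Set.Iio (0 - y)) := by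
        intro y; congr 1; ext x; simp [lt_neg_iff_add_neg]
      simp_rw [e]
      exact Antitone.measurable fun a b hab => measure_mono (Set.Iio_subset_Iio (by linarith))

theorem conv_real_Iic (ν η : Measure ℝ) [IsProbabilityMeasure ν] [IsProbabilityMeasure η] (x : ℝ) :
    (ν ∗ η).real (Set.Iic x) = ∫ y, ν.real (Set.Iic (x - y)) ∂η := by
  have e : ∀ y : ℝ, ((fun x => x + y) ⁻¹' Set.Iic x) = Set.Iic (x - y) := by
    intro y; ext z; simp [le_sub_iff_add_le]
  rw [measureReal_def, conv_apply_eq _ _ measurableSet_Iic]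
  simp_rw [e]
  rw [integral_eq_lintegral_of_nonneg_ae (Eventually.of_forall fun _ => measureReal_nonneg)]
  · congr 1
    refine lintegral_congr fun y => ?_
    rw [measureReal_def, ENNReal.ofReal_toReal (measure_ne_top _ _)]
  · exact (Antitone.measurable fun a b hab =>
      measureReal_mono (Set.Iic_subset_Iic.2 (by linarith))).aestronglyMeasurable

theorem lipschitzWith_real_Iic {ν : Measure ℝ} [IsProbabilityMeasure ν] {c : NNReal}
    (hν : ∀ A, MeasurableSet A → ν A ≤ c * volume A) :
    LipschitzWith c fun t => ν.real (Set.Iic t) := by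
  refine LipschitzWith.of_le_add_mul c fun x y => ?_
  rcases le_total x y with h | h
  · have h1 : ν.real (Set.Iic x) ≤ ν.real (Set.Iic y) := measureReal_mono (Set.Iic_subset_Iic.2 h)
    have : 0 ≤ (c : ℝ) * dist x y := by positivity
    linarith
  · have h1 : ν.real (Set.Iic x) ≤ ν.real (Set.Iic y) + ν.real (Set.Ioc y x) := by
      rw [← Set.Iic_union_Ioc_eq_Iic h]
      exact measureReal_union_le _ _
    have h2 : ν.real (Set.Ioc y x) ≤ c * dist x y := by
      rw [measureReal_def, Real.dist_eq, abs_of_nonneg (by linarith)]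
      refine ENNReal.toReal_le_of_le_ofReal (by have : 0 ≤ x - y := by linarith
                                                positivity) ?_
      refine (hν _ measurableSet_Ioc).trans (le_of_eq ?_)
      rw [Real.volume_Ioc, ENNReal.ofReal_mul c.coe_nonneg, ENNReal.ofReal_coe_nnreal]
    linarith

/-- A bounded density makes the distribution function of `ν` Lipschitz. This dominates the
difference quotients, so differentiability at almost every shifted point suffices. -/
theorem differentiableAt_conv_real_Iic {ν η : Measure ℝ} [IsProbabilityMeasure ν]
    [IsProbabilityMeasure η] {c : NNReal} (hν : ∀ A, MeasurableSet A → ν A ≤ c * volume A)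
    {x₀ : ℝ} (hd : ∀ᵐ y ∂η, DifferentiableAt ℝ (fun t => ν.real (Set.Iic t)) (x₀ - y)) :
    DifferentiableAt ℝ (fun x => (ν ∗ η).real (Set.Iic x)) x₀ := by
  set F : ℝ → ℝ := fun t => ν.real (Set.Iic t) with hF
  have hL : LipschitzWith c F := lipschitzWith_real_Iic hν
  have hFm : Measurable F := hL.continuous.measurable
  simp_rw [conv_real_Iic]
  have h := hasDerivAt_integral_of_dominated_loc_of_lip (μ := η) (F := fun x y => F (x - y))
    (F' := fun y => deriv F (x₀ - y)) (x₀ := x₀) (s := Set.univ) (bound := fun _ => (c : ℝ))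
    univ_mem
    (Eventually.of_forall fun x => (hFm.comp (measurable_const.sub measurable_id)).aestronglyMeasurable)
    ?_ ?_ ?_ (integrable_const _) ?_
  · exact h.2.differentiableAt
  · refine Integrable.mono' (integrable_const 1)
      (hFm.comp (measurable_const.sub measurable_id)).aestronglyMeasurable
      (Eventually.of_forall fun y => ?_)
    rw [Real.norm_of_nonneg measureReal_nonneg]
    exact measureReal_le_one
  · exact ((measurable_deriv F).comp (measurable_const.sub measurable_id)).aestronglyMeasurable
  · refine Eventually.of_forall fun y => ?_
    rw [lipschitzOnWith_univ]
    have : Real.nnabs (c : ℝ) = c := by ext; simp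
    rw [this]
    have h2 := hL.comp (LipschitzWith.id.sub (LipschitzWith.const (α := ℝ) y))
    simpa [Function.comp_def] using h2
  · filter_upwards [hd] with y hy
    have h3 := hy.hasDerivAt
    exact h3.comp_sub_const x₀ y

/-- One summand is split off; its distribution function is differentiable away from `0` and `β`. For
`T ≥ 2` the remaining sum has no atoms, so the two exceptional shifts are null; for `T = 1` it is
the Dirac mass at `0`, and `r ≠ β` is required. -/
theorem differentiableAt_sumLaw_real_Iic {K β r : ℝ} (hK : 0 < K) (hβ : 0 < β) (hr : 0 < r) {T : ℕ}
    (hT : 1 ≤ T) (h1 : T = 1 → r ≠ β) :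
    DifferentiableAt ℝ (fun x => (sumLaw (sinrLaw K β) T).real (Set.Iic x)) r := by
  have hν : ∀ A, MeasurableSet A → sinrLaw K β A
      ≤ ((Real.toNNReal (Real.exp K / K * (2 / β)) : NNReal) : ENNReal) * volume A :=
    fun A hA => sinrLaw_le hK hβ hA
  obtain ⟨t, rfl⟩ : ∃ t, T = t + 1 := ⟨T - 1, by omega⟩
  rw [sumLaw]
  refine differentiableAt_conv_real_Iic hν ?_
  have key : ∀ᵐ y ∂sumLaw (sinrLaw K β) t, y ≠ r ∧ y ≠ r - β := by
    cases t with
    | zero =>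
      rw [sumLaw, ae_dirac_iff (by measurability)]
      exact ⟨hr.ne, fun h => h1 rfl (by linarith)⟩
    | succ t =>
      have hz : ∀ c : ℝ, ∀ᵐ y ∂sumLaw (sinrLaw K β) (t + 1), y ≠ c := by
        intro c
        rw [ae_iff, sumLaw]
        have := conv_le_mul_volume (η := sumLaw (sinrLaw K β) t) hν (measurableSet_singleton c)
        simpa using this
      exact (hz r).and (hz (r - β))
  filter_upwards [key] with y hy
  exact differentiableAt_sinrLaw_real_Iic hK hβ (sub_ne_zero.2 hy.1.symm)
    (fun h => hy.2 (by linarith))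

theorem sumLaw_real_Iic_le {K β : ℝ} (hK : 0 < K) (hβ : 0 < β) {T : ℕ} (hT : 1 ≤ T) {x : ℝ}
    (hx : 0 ≤ x) :
    (sumLaw (sinrLaw K β) T).real (Set.Iic x) ≤ Real.exp K / K * (2 / β) * x := by
  have hν : ∀ A, MeasurableSet A → sinrLaw K β A
      ≤ ((Real.toNNReal (Real.exp K / K * (2 / β)) : NNReal) : ENNReal) * volume A :=
    fun A hA => sinrLaw_le hK hβ hA
  have h0 := sumLaw_Iio_zero (sinrLaw_Iic_zero hK hβ) T
  obtain ⟨t, rfl⟩ : ∃ t, T = t + 1 := ⟨T - 1, by omega⟩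
  have h1 : sumLaw (sinrLaw K β) (t + 1) (Set.Icc 0 x)
      ≤ ENNReal.ofReal (Real.exp K / K * (2 / β) * x) := by
    refine (conv_le_mul_volume (η := sumLaw (sinrLaw K β) t) hν measurableSet_Icc).trans ?_
    rw [Real.volume_Icc, sub_zero, ENNReal.ofReal_mul (by positivity)]
    rfl
  refine ENNReal.toReal_le_of_le_ofReal (by positivity) ?_
  have hsub : Set.Iic x ⊆ Set.Iio 0 ∪ Set.Icc 0 x := fun y hy => by
    rcases lt_or_ge y 0 with h | h
    · exact Or.inl h
    · exact Or.inr ⟨h, hy⟩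
  refine (measure_mono hsub).trans ((measure_union_le _ _).trans ?_)
  rw [h0, zero_add]
  exact h1

/-! ### The outer angular integral as a Laplace transform -/

theorem image_two_div_one_add_cos {a : ℝ} (ha : 0 < a) :
    (fun φ : ℝ => 2 * a / (1 + Real.cos φ)) '' Set.Ioo 0 Real.pi = Set.Ioi a := by
  ext u
  simp only [Set.mem_image, Set.mem_Ioi]
  constructor
  · rintro ⟨φ, hφ, rfl⟩
    have hc := cos_mem_Ioo hφ
    rw [lt_div_iff₀ (by linarith [hc.1])]
    nlinarith [hc.2]
  · intro hu
    have hu0 : 0 < u := ha.trans hu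
    have h1 : -1 < 2 * a / u - 1 := by have : 0 < 2 * a / u := by positivity
                                       linarith
    have h2 : 2 * a / u - 1 < 1 := by
      have : 2 * a / u < 2 := by rw [div_lt_iff₀ hu0]; linarith
      linarith
    refine ⟨Real.arccos (2 * a / u - 1), ⟨Real.arccos_pos.2 h2, ?_⟩, ?_⟩
    · refine lt_of_le_of_ne (Real.arccos_le_pi _) fun h => ?_
      rw [Real.arccos_eq_pi] at h
      linarith
    · rw [Real.cos_arccos h1.le h2.le]
      field_simp
      ring

/-- For `u = 2 a / (1 + cos φ)` the angular weight is exactly `du / u`. -/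
theorem lintegral_sin_div_mul_exp {a b : ℝ} (ha : 0 < a) :
    ∫⁻ φ in Set.Ioo 0 Real.pi, ENNReal.ofReal (Real.sin φ / (1 + Real.cos φ)) *
        ENNReal.ofReal (Real.exp (-(b * (2 * a / (1 + Real.cos φ)))))
      = ∫⁻ u in Set.Ioi a, ENNReal.ofReal (Real.exp (-(b * u)) / u) := by
  rw [← image_two_div_one_add_cos ha, lintegral_image_eq_lintegral_abs_deriv_mul
    (f' := fun φ => 2 * a * Real.sin φ / (1 + Real.cos φ) ^ 2) measurableSet_Ioo]
  · refine setLIntegral_congr_fun measurableSet_Ioo fun φ hφ => ?_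
    have h0 := Real.sin_pos_of_mem_Ioo hφ
    have hc : 0 < 1 + Real.cos φ := by linarith [(cos_mem_Ioo hφ).1]
    rw [abs_of_nonneg (by positivity), ← ENNReal.ofReal_mul (by positivity),
      ← ENNReal.ofReal_mul (by positivity)]
    congr 1
    field_simp
  · intro φ hφ
    have hc : 1 + Real.cos φ ≠ 0 := by linarith [(cos_mem_Ioo hφ).1]
    have h2 : HasDerivAt (fun φ => 1 + Real.cos φ) (-Real.sin φ) φ :=
      (Real.hasDerivAt_cos φ).const_add 1
    refine (((hasDerivAt_const φ (2 * a)).div h2 hc).congr_deriv ?_).hasDerivWithinAt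
    ring
  · intro x hx y hy hxy
    have h1 : 1 + Real.cos x ≠ 0 := by linarith [(cos_mem_Ioo hx).1]
    have h2 : 1 + Real.cos y ≠ 0 := by linarith [(cos_mem_Ioo hy).1]
    refine Real.injOn_cos (Set.Ioo_subset_Icc_self hx) (Set.Ioo_subset_Icc_self hy) ?_
    simp only at hxy
    have := ha.ne'
    field_simp at hxy
    linarith

/-- Integrating the Laplace transform of `μ` over the angle gives the Laplace transform of the
distribution function of `μ` divided by its argument. -/
theorem lintegral_laplace_eq {μ : Measure ℝ} [IsProbabilityMeasure μ] (hμ : μ (Set.Iic 0) = 0)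
    {b r : ℝ} (hr : 0 < r) :
    ∫⁻ φ in Set.Ioo 0 Real.pi, ENNReal.ofReal (Real.sin φ / (1 + Real.cos φ)) *
        ∫⁻ x, ENNReal.ofReal (Real.exp (-(2 * b / r / (1 + Real.cos φ) * x))) ∂μ
      = ∫⁻ u in Set.Ioi 0, ENNReal.ofReal (Real.exp (-(b * u)) / u) * μ (Set.Iic (r * u)) := by
  have hpos : ∀ᵐ x ∂μ, 0 < x := by
    rw [ae_iff]; simpa [Set.Iic_def] using hμ
  calc _ = ∫⁻ φ in Set.Ioo 0 Real.pi, ∫⁻ x, ENNReal.ofReal (Real.sin φ / (1 + Real.cos φ)) *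
        ENNReal.ofReal (Real.exp (-(2 * b / r / (1 + Real.cos φ) * x))) ∂μ := by
        refine lintegral_congr fun φ => ?_
        rw [lintegral_const_mul _ (by fun_prop)]
    _ = ∫⁻ x, (∫⁻ φ in Set.Ioo 0 Real.pi, ENNReal.ofReal (Real.sin φ / (1 + Real.cos φ)) *
        ENNReal.ofReal (Real.exp (-(2 * b / r / (1 + Real.cos φ) * x)))) ∂μ := by
        refine lintegral_lintegral_swap (f := fun φ x =>
          ENNReal.ofReal (Real.sin φ / (1 + Real.cos φ)) *
            ENNReal.ofReal (Real.exp (-(2 * b / r / (1 + Real.cos φ) * x)))) ?_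
        exact Measurable.aemeasurable (by unfold Function.uncurry; fun_prop)
    _ = ∫⁻ x, (∫⁻ u in Set.Ioi 0, ENNReal.ofReal (Real.exp (-(b * u)) / u) *
          (Set.Iic (r * u)).indicator 1 x) ∂μ := by
        refine lintegral_congr_ae ?_
        filter_upwards [hpos] with x hx
        have ha : 0 < x / r := by positivity
        have e : ∀ φ : ℝ, 2 * b / r / (1 + Real.cos φ) * x
            = b * (2 * (x / r) / (1 + Real.cos φ)) := fun φ => by ring
        simp_rw [e]
        -- Passing from `u > x / r` to `u ≥ x / r` makes the domain match the closed event `x ≤ r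
        -- u`.
        rw [lintegral_sin_div_mul_exp ha, setLIntegral_congr Ioi_ae_eq_Ici]
        have e2 : ∀ u : ℝ, ENNReal.ofReal (Real.exp (-(b * u)) / u) *
            (Set.Iic (r * u)).indicator 1 x = (Set.Ici (x / r)).indicator
              (fun u => ENNReal.ofReal (Real.exp (-(b * u)) / u)) u := by
          intro u
          have : x ∈ Set.Iic (r * u) ↔ u ∈ Set.Ici (x / r) := by
            rw [Set.mem_Iic, Set.mem_Ici, div_le_iff₀ hr, mul_comm]
          by_cases h : u ∈ Set.Ici (x / r)
          · simp [Set.indicator_of_mem h, Set.indicator_of_mem (this.2 h)]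
          · simp [Set.indicator_of_notMem h, Set.indicator_of_notMem (mt this.1 h)]
        simp_rw [e2]
        rw [setLIntegral_indicator measurableSet_Ici,
          Set.inter_eq_left.2 (Set.Ici_subset_Ioi.2 ha)]
    _ = ∫⁻ u in Set.Ioi 0, ∫⁻ x, ENNReal.ofReal (Real.exp (-(b * u)) / u) *
          (Set.Iic (r * u)).indicator 1 x ∂μ := by
        refine lintegral_lintegral_swap (f := fun x u =>
          ENNReal.ofReal (Real.exp (-(b * u)) / u) * (Set.Iic (r * u)).indicator 1 x) ?_
        refine Measurable.aemeasurable ?_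
        refine Measurable.mul (by fun_prop) ?_
        have : (fun p : ℝ × ℝ => (Set.Iic (r * p.2)).indicator (1 : ℝ → ENNReal) p.1)
            = {p : ℝ × ℝ | p.1 ≤ r * p.2}.indicator 1 := by
          ext p; simp [Set.indicator]
        change Measurable fun p : ℝ × ℝ => (Set.Iic (r * p.2)).indicator (1 : ℝ → ENNReal) p.1
        rw [this]
        exact measurable_one.indicator (measurableSet_le (by fun_prop) (by fun_prop))
    _ = _ := by
        refine lintegral_congr fun u => ?_
        rw [lintegral_const_mul _ (measurable_one.indicator measurableSet_Iic),
          lintegral_indicator_one measurableSet_Iic]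

theorem measurable_real_Iic (μ : Measure ℝ) [IsProbabilityMeasure μ] :
    Measurable fun x => μ.real (Set.Iic x) :=
  Monotone.measurable fun _ _ h => measureReal_mono (Set.Iic_subset_Iic.2 h)

theorem integral_laplaceSinr_pow_eq {K β b r : ℝ} (hK : 0 < K) (hβ : 0 < β) (hb : 0 ≤ b)
    (hr : 0 < r) {T : ℕ} (hT : 1 ≤ T) :
    ∫ φ in (0 : ℝ)..Real.pi, Real.sin φ / (1 + Real.cos φ) *
        laplaceSinr K β (2 * b / r / (1 + Real.cos φ)) ^ T
      = ∫ u in Set.Ioi (0 : ℝ), Real.exp (-(b * u)) *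
        ((sumLaw (sinrLaw K β) T).real (Set.Iic (r * u)) / u) := by
  set μ := sumLaw (sinrLaw K β) T with hμ
  have hμ0 : μ (Set.Iic 0) = 0 := by
    have := sumLaw_real_Iic_le hK hβ hT le_rfl
    rw [mul_zero] at this
    have h0 := le_antisymm this measureReal_nonneg
    rwa [measureReal_eq_zero_iff] at h0
  have hL : ∀ s : ℝ, 0 ≤ s → ∫⁻ x, ENNReal.ofReal (Real.exp (-(s * x))) ∂μ
      = ENNReal.ofReal (laplaceSinr K β s ^ T) := by
    intro s hs
    have h0 := laplaceSinr_nonneg (β := β) (s := s) hK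
    rw [hμ, lintegral_exp_neg_sumLaw, lintegral_exp_neg_sinrLaw hK hβ hs, ENNReal.ofReal_pow h0]
  have hmeas : Measurable fun s : ℝ => ∫⁻ x, ENNReal.ofReal (Real.exp (-(s * x))) ∂μ :=
    Measurable.lintegral_prod_right' (f := fun p : ℝ × ℝ => ENNReal.ofReal (Real.exp (-(p.1 * p.2))))
      (by fun_prop)
  -- Replacing `laplaceSinr` by the Laplace integral of `μ` makes measurability in `s` immediate and
  -- reduces the claim to nonnegative integrals.
  have h1 : ∫ φ in (0 : ℝ)..Real.pi, Real.sin φ / (1 + Real.cos φ) *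
        laplaceSinr K β (2 * b / r / (1 + Real.cos φ)) ^ T
      = ∫ φ in Set.Ioo 0 Real.pi, Real.sin φ / (1 + Real.cos φ) *
        (∫⁻ x, ENNReal.ofReal (Real.exp (-(2 * b / r / (1 + Real.cos φ) * x))) ∂μ).toReal := by
    rw [intervalIntegral.integral_of_le Real.pi_pos.le, integral_Ioc_eq_integral_Ioo]
    refine setIntegral_congr_fun measurableSet_Ioo fun φ hφ => ?_
    have hc : 0 < 1 + Real.cos φ := by linarith [(cos_mem_Ioo hφ).1]
    have hs : 0 ≤ 2 * b / r / (1 + Real.cos φ) := by positivity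
    rw [hL _ hs, ENNReal.toReal_ofReal]
    exact pow_nonneg (laplaceSinr_nonneg hK) T
  have hfin : ∀ s : ℝ, 0 ≤ s → ∫⁻ x, ENNReal.ofReal (Real.exp (-(s * x))) ∂μ ≠ ⊤ := by
    intro s hs
    rw [hL s hs]; exact ENNReal.ofReal_ne_top
  rw [h1, integral_eq_lintegral_of_nonneg_ae, integral_eq_lintegral_of_nonneg_ae]
  · congr 1
    refine Eq.trans ?_ ((lintegral_laplace_eq (b := b) hμ0 hr).trans ?_)
    · refine setLIntegral_congr_fun measurableSet_Ioo fun φ hφ => ?_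
      have h0 := Real.sin_pos_of_mem_Ioo hφ
      have hc : 0 < 1 + Real.cos φ := by linarith [(cos_mem_Ioo hφ).1]
      rw [ENNReal.ofReal_mul (by positivity), ENNReal.ofReal_toReal (hfin _ (by positivity))]
    · refine setLIntegral_congr_fun measurableSet_Ioi fun u hu => ?_
      have hu0 : 0 < u := hu
      rw [mul_div_assoc', mul_div_right_comm, ENNReal.ofReal_mul (by positivity), measureReal_def,
        ENNReal.ofReal_toReal (measure_ne_top _ _)]
  · rw [EventuallyLE, ae_restrict_iff' measurableSet_Ioi]
    refine Eventually.of_forall fun u hu => ?_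
    have hu0 : 0 < u := hu
    simp only [Pi.zero_apply]
    positivity
  · refine Measurable.aestronglyMeasurable ?_
    exact (by fun_prop : Measurable fun u : ℝ => Real.exp (-(b * u))).mul
      (((measurable_real_Iic μ).comp (measurable_const_mul r)).div measurable_id)
  · rw [EventuallyLE, ae_restrict_iff' measurableSet_Ioo]
    refine Eventually.of_forall fun φ hφ => ?_
    have h0 := Real.sin_pos_of_mem_Ioo hφ
    have hc : 0 < 1 + Real.cos φ := by linarith [(cos_mem_Ioo hφ).1]
    simp only [Pi.zero_apply]
    positivity
  · refine Measurable.aestronglyMeasurable ?_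
    exact (by fun_prop : Measurable fun φ : ℝ => Real.sin φ / (1 + Real.cos φ)).mul
      (hmeas.comp (by fun_prop : Measurable fun φ : ℝ =>
        2 * b / r / (1 + Real.cos φ))).ennreal_toReal

/-! ### The limit in the Gaver–Stehfest order -/

theorem sum_weight_mul_integral_eq {G : ℝ → ℝ} {C : ℝ} (hG : Measurable G)
    (hC : ∀ u, 0 < u → |G u| ≤ C) (n : ℕ) :
    ∑ k ∈ Finset.Icc 1 (2 * n), Real.log 2 * weight (2 * n) k *
        ∫ u in Set.Ioi (0 : ℝ), Real.exp (-(k * Real.log 2 * u)) * G u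
      = ∫ u in Set.Ioi (0 : ℝ),
        Real.log 2 * stehfestPoly n (Real.exp (-(Real.log 2 * u))) * G u := by
  have hl : 0 < Real.log 2 := Real.log_pos one_lt_two
  have hC0 : 0 ≤ C := (abs_nonneg _).trans (hC 1 one_pos)
  simp_rw [← integral_const_mul]
  rw [← integral_finsetSum]
  · refine integral_congr_ae (Eventually.of_forall fun u => ?_)
    simp only [stehfestPoly, Finset.mul_sum, Finset.sum_mul]
    refine Finset.sum_congr rfl fun k _ => ?_
    rw [← Real.exp_nat_mul, show (k : ℝ) * -(Real.log 2 * u) = -(k * Real.log 2 * u) by ring]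
    ring
  · intro k hk
    have hk1 : (1 : ℝ) ≤ k := by exact_mod_cast (Finset.mem_Icc.1 hk).1
    refine Integrable.const_mul ?_ _
    have hi : IntegrableOn (fun u => C * Real.exp (-(k * Real.log 2) * u)) (Set.Ioi 0) :=
      (integrableOn_exp_mul_Ioi (by have : 0 < k * Real.log 2 := by positivity
                                    linarith) 0).const_mul C
    refine Integrable.mono' hi
      ((by fun_prop : Measurable fun u : ℝ =>
        Real.exp (-(k * Real.log 2 * u))).mul hG).aestronglyMeasurable ?_
    rw [ae_restrict_iff' measurableSet_Ioi]
    refine Eventually.of_forall fun u hu => ?_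
    rw [Real.norm_eq_abs, abs_mul, abs_of_pos (Real.exp_pos _), mul_comm, neg_mul]
    exact mul_le_mul_of_nonneg_right (hC u hu) (Real.exp_pos _).le

/-- Inversion at `u = 1` of `G u = F (r u) / u`, where `F` is the distribution function of the sum.
The linear bound on `F` at the origin keeps `G` bounded. -/
theorem tendsto_stehfest_sumLaw {K β r : ℝ} (hK : 0 < K) (hβ : 0 < β) (hr : 0 < r) {T : ℕ}
    (hT : 1 ≤ T) (h1 : T = 1 → r ≠ β) :
    Tendsto (fun n : ℕ => ∑ k ∈ Finset.Icc 1 (2 * n), Real.log 2 * weight (2 * n) k *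
        ∫ φ in (0 : ℝ)..Real.pi, Real.sin φ / (1 + Real.cos φ) *
          laplaceSinr K β (2 * k * Real.log 2 / r / (1 + Real.cos φ)) ^ T)
      atTop (𝓝 ((sumLaw (sinrLaw K β) T).real (Set.Iic r))) := by
  have hl : 0 < Real.log 2 := Real.log_pos one_lt_two
  set μ := sumLaw (sinrLaw K β) T with hμ
  set G : ℝ → ℝ := fun u => μ.real (Set.Iic (r * u)) / u with hG
  have hGm : Measurable G :=
    ((measurable_real_Iic μ).comp (measurable_const_mul r)).div measurable_id
  have hGb : ∀ u, 0 < u → |G u| ≤ Real.exp K / K * (2 / β) * r := by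
    intro u hu
    rw [abs_of_nonneg (by simp only [hG]; positivity)]
    simp only [hG]
    rw [div_le_iff₀ hu, mul_assoc _ r u]
    exact sumLaw_real_Iic_le hK hβ hT (by positivity)
  have hGd : DifferentiableAt ℝ G 1 := by
    have hd := differentiableAt_sumLaw_real_Iic hK hβ hr hT h1
    have h2 : DifferentiableAt ℝ (fun u => μ.real (Set.Iic (r * u))) 1 :=
      DifferentiableAt.comp (1 : ℝ) (g := fun x => μ.real (Set.Iic x)) (f := fun u => r * u)
        (by simpa using hd) (by fun_prop)
    exact h2.div differentiableAt_id one_ne_zero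
  have hG1 : G 1 = μ.real (Set.Iic r) := by simp [hG]
  -- The kernel estimates concern order `2 (m + 1)`, hence the shift of the index by one.
  rw [← hG1, ← tendsto_add_atTop_iff_nat 1]
  refine (tendsto_integral_stehfestPoly_exp hGm hGb hGd).congr fun m => ?_
  rw [← sum_weight_mul_integral_eq hGm hGb]
  refine Finset.sum_congr rfl fun k _ => ?_
  rw [mul_assoc 2 (k : ℝ), integral_laplaceSinr_pow_eq hK hβ (by positivity) hr hT]

/-! ### From the channel model to the outage probability -/

theorem sinr_channel_eq {α₁ α₂ ρ d ζ : ℝ} (hα₂ : 0 < α₂) (hρ : 0 < ρ)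
    (hd : 0 < d) (z : ℂ) :
    sinr α₁ α₂ ρ (channel d ζ z) =
      α₁ / α₂ * ‖z‖ ^ 2 / (‖z‖ ^ 2 + 1 / (α₂ * pathGain d ζ * ρ)) := by
  have h : 0 < 1 + d ^ ζ := by positivity
  have hn : ‖channel d ζ z‖ ^ 2 = ‖z‖ ^ 2 / (1 + d ^ ζ) := by
    rw [channel, norm_div, Complex.norm_real, Real.norm_of_nonneg (Real.sqrt_nonneg _), div_pow,
      Real.sq_sqrt h.le]
  rw [sinr, hn, pathGain]
  field_simp

theorem map_sinr_eq_sinrLaw {Ω : Type*} [MeasurableSpace Ω] {P : Measure Ω}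
    {α₁ α₂ ρ d ζ : ℝ} (hα₂ : 0 < α₂) (hρ : 0 < ρ) (hd : 0 < d) {g : Ω → ℂ}
    (hg : HasLaw g complexGaussian P) :
    P.map (fun ω => sinr α₁ α₂ ρ (channel d ζ (g ω)))
      = sinrLaw (1 / (α₂ * pathGain d ζ * ρ)) (α₁ / α₂) := by
  simp_rw [sinr_channel_eq hα₂ hρ hd]
  rw [sinrLaw, ← map_norm_sq_complexGaussian, ← hg.map_eq,
    AEMeasurable.map_map_of_aemeasurable (by fun_prop) hg.aemeasurable,
    AEMeasurable.map_map_of_aemeasurable (by fun_prop)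
      (Measurable.comp_aemeasurable (by fun_prop) hg.aemeasurable)]
  rfl

theorem outage_eq {Ω : Type*} [MeasurableSpace Ω] (P : Measure Ω) [IsProbabilityMeasure P]
    {α₁ α₂ ρ d ζ R : ℝ} {T : ℕ} {g : Fin T → Ω → ℂ} (hα₁ : 0 < α₁) (hα₂ : 0 < α₂) (hρ : 0 < ρ)
    (hd : 0 < d) (hlaw : ∀ t, HasLaw (g t) complexGaussian P) (hindep : iIndepFun g P) :
    outage P α₁ α₂ ρ d ζ R T g
      = (sumLaw (sinrLaw (1 / (α₂ * pathGain d ζ * ρ)) (α₁ / α₂)) T).real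
        (Set.Iic ((2 : ℝ) ^ (T * R) - 1)) := by
  set f : ℂ → ℝ := fun z => sinr α₁ α₂ ρ (channel d ζ z) with hf
  have hfm : Measurable f := by
    simp only [hf, sinr_channel_eq hα₂ hρ hd]; fun_prop
  have hX : ∀ t, AEMeasurable (fun ω => f (g t ω)) P := fun t =>
    hfm.comp_aemeasurable (hlaw t).aemeasurable
  have hind : iIndepFun (fun t ω => f (g t ω)) P := hindep.comp (fun _ => f) fun _ => hfm
  have hsum := map_sum_eq_sumLaw hX hind
    (fun t => map_sinr_eq_sinrLaw hα₂ hρ hd (hlaw t)) Finset.univ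
  rw [Finset.card_univ, Fintype.card_fin] at hsum
  rw [← hsum, map_measureReal_apply_of_aemeasurable (Finset.aemeasurable_sum _ fun t _ => hX t)
    measurableSet_Iic, outage]
  congr 1
  ext ω
  have hnn : 0 ≤ ∑ t, f (g t ω) := Finset.sum_nonneg fun t _ => by
    simp only [hf, sinr]; positivity
  simp only [Set.mem_ofPred_eq, Set.mem_preimage, Set.mem_Iic, Finset.sum_apply]
  rw [Real.logb_le_iff_le_rpow one_lt_two (by linarith)]
  constructor <;> intro h <;> linarith

end HarqNoma

theorem theorem1 {Ω : Type*} [MeasurableSpace Ω] (P : Measure Ω) [IsProbabilityMeasure P]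
    (α₁ α₂ ρ d ζ R : ℝ) (T : ℕ) (g : Fin T → Ω → ℂ)
    (hα₁ : 0 < α₁) (hα₂ : 0 < α₂) (hα : α₁ + α₂ = 1)
    (hρ : 0 < ρ) (hd : 0 < d) (hT : 1 ≤ T)
    (hlaw : ∀ t, HasLaw (g t) HarqNoma.complexGaussian P)
    (hindep : iIndepFun g P)
    (hr₀ : 0 < (2 : ℝ) ^ R - 1) (hr₁ : (2 : ℝ) ^ R - 1 < α₁ / α₂) :
    ∃ B : ℕ → ℝ,
      (∀ M : ℕ, 1 ≤ M →
        Tendsto (fun N : ℕ => HarqNoma.closedForm α₁ α₂ ρ (HarqNoma.pathGain d ζ)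
          ((2 : ℝ) ^ (T * R) - 1) T N (2 * M)) atTop (𝓝 (B M))) ∧
      Tendsto B atTop (𝓝 (HarqNoma.outage P α₁ α₂ ρ d ζ R T g)) := by
  have hlam : 0 < HarqNoma.pathGain d ζ := by unfold HarqNoma.pathGain; positivity
  have hR : 0 < R := by
    by_contra h
    have := Real.rpow_le_one_of_one_le_of_nonpos one_le_two (not_lt.1 h)
    linarith
  have hT' : (1 : ℝ) ≤ T := by exact_mod_cast hT
  have hr : 0 < (2 : ℝ) ^ (T * R) - 1 := by
    have := Real.one_lt_rpow one_lt_two (by positivity : 0 < (T : ℝ) * R)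
    linarith
  refine ⟨_, fun M _ => HarqNoma.tendsto_closedForm hα₁ hα₂ hρ hlam hr hT (2 * M), ?_⟩
  rw [HarqNoma.outage_eq P hα₁ hα₂ hρ hd hlaw hindep]
  refine HarqNoma.tendsto_stehfest_sumLaw (by positivity) (by positivity) hr hT ?_
  -- Only for `T = 1` can `r = β` matter; there `r = 2 ^ R - 1 < β` by the rate assumption.
  rintro rfl
  rw [Nat.cast_one, one_mul]
  exact hr₁.ne
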